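/- Let $\mathbf F_q$ be a finite field with $q$ odd and characteristic $p$, $A=\mathbf F_q[t]$, $K=\mathbf F_q(t)$. Let $\mathfrak p\neq 0$ be a prime ideal of $A$ with monic generator $\pi$, $K_{\mathfrak p}$ the completion of $K$ at $\mathfrak p$ with valuation ring $A_{\mathfrak p}$, and $\xi$ a root of $\pi$ in an algebraic closure of $\mathbf F_q$. For $f\in K$ put $\chi_{\mathfrak p}(f)=\exp\bigl(2\pi i\,\mathrm{Tr}(\mathrm{Res}_\xi f)/p\bigr)$, where $\mathrm{Res}_\xi f\in\mathbf F_q(\xi)$ is the coefficient of $(t-\xi)^{-1}$ in the Laurent expansion of $f$ at $\xi$ and $\mathrm{Tr}:\mathbf F_q(\xi)\to\mathbf F_p$ is the trace. A quadratic space $(W,Q)$ over $K$ is definite if $Q$ is anisotropic over $K_\infty=\mathbf F_q((1/t))$. For an $A$-lattice $L$ (finitely generated, spanning $W$ over $K$; $Q$ need not be integral on $L$) let $L_m=\{x\in L:\deg Q(x)\le m\}$ (with $\deg 0=-\infty$), $R(L,Q,a)=|\{x\in L: Q(x)=a\}|$ for $a\in K$, and $$\mu(L,Q,\chi_{\mathfrak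 p})=\lim_{m\to\infty}\frac1{|L_m|}\sum_{x\in L_m}\chi_{\mathfrak p}(Q(x)).$$ Let $L_{\mathfrak p}$ be the $A_{\mathfrak p}$-lattice generated by $L$ in $K_{\mathfrak p}\otimes_K W$, with the form induced by $Q$. Theorem. Let $(W,Q)$, $(W',Q')$ be definite quadratic spaces over $K$ and let $L\subset W$, $L'\subset W'$ be $A$-lattices. In $\mu(L,\pi^{-k}Q,\chi_{\mathfrak p})$ the sets $L_m$ are those of the form $\pi^{-k}Q$. 1. For every $k\in\mathbf Z$ the sets $L_m$ (formed with respect to $\pi^{-k}Q$) are finite, and the averages defining $\mu(L,\pi^{-k}Q,\chi_{\mathfrak p})$ are constant for all large $m$, so that the limit exists. 2. If $R(L,Q,a)=R(L',Q',a)$ for all $a\in K$, then $\mu(L,\pi^{-k}Q,\chi_{\mathfrak p})=\mu(L',\pi^{-k}Q',\chi_{\mathfrak p})$ for all $k\in\mathbf Z$. 3. Suppose that $Q(L)\subset A_{\mathfrak p}$. If $\mu(L,\pi^{-k}Q,\chi_{\mathfrak p})=\mu(L',\pi^{-k}Q',\chi_{\mathfrak p})$ for $k=0,1,2,\ldots$,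 then $(L_{\mathfrak p},Q)$ and $(L'_{\mathfrak p},Q')$ are isometric over $A_{\mathfrak p}$. 4. Without any integrality assumption, if $\mu(L,\pi^{-k}Q,\chi_{\mathfrak p})=\mu(L',\pi^{-k}Q',\chi_{\mathfrak p})$ for all $k\in\mathbf Z$, then $(L_{\mathfrak p},Q)$ and $(L'_{\mathfrak p},Q')$ are isometric over $A_{\mathfrak p}$. -/

import Mathlib

open Polynomial IsDedekindDomain Filter
open scoped TensorProduct

noncomputable section

namespace Lattices

variable {F : Type*} [Field F]

/-- The standard additive character `x ↦ exp (2πi Tr(x) / p)` of a field `κ` of characteristic `p`,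
where `Tr : κ → 𝔽_p` is the trace to the prime field. -/
def traceChar (κ : Type*) [Field κ] (x : κ) : ℂ :=
  letI : Algebra (ZMod (ringChar κ)) κ := ZMod.algebra κ (ringChar κ)
  Complex.exp (2 * Real.pi * Complex.I *
    ((Algebra.trace (ZMod (ringChar κ)) κ x).val : ℂ) / (ringChar κ : ℂ))

/-- The expansion of a rational function `f(t)` at the point `ξ`, as a Laurent series in
`T = t - ξ` with coefficients in `F(ξ)`: substitute `t = ξ + T`. -/
def laurentExpansion (ξ : AlgebraicClosure F) (f : RatFunc F) :
    LaurentSeries (IntermediateField.adjoin F {ξ}) :=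
  RatFunc.eval
    ((HahnSeries.C : _ →+* LaurentSeries (IntermediateField.adjoin F {ξ})).comp
      (algebraMap F (IntermediateField.adjoin F {ξ})))
    (HahnSeries.C (IntermediateField.AdjoinSimple.gen F ξ) + HahnSeries.single 1 1) f

/-- The residue at `ξ`: the coefficient of `(t - ξ)⁻¹`. -/
def residue (ξ : AlgebraicClosure F) (f : RatFunc F) : IntermediateField.adjoin F {ξ} :=
  (laurentExpansion ξ f).coeff (-1)

/-- The canonical character `χ_𝔭` attached to the prime `𝔭` of `F[t]` having `ξ` as a root,
on elements of `K = F(t)`. -/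
def canonicalChar (ξ : AlgebraicClosure F) (f : RatFunc F) : ℂ :=
  traceChar (IntermediateField.adjoin F {ξ}) (residue ξ f)

section Global

variable {W : Type*} [AddCommGroup W] [Module F[X] W] [Module (RatFunc F) W]

open Classical in
/-- A quadratic form over `K = F(t)` is definite if it is anisotropic over `K_∞ = F((1/t))`. -/
def IsDefinite [Invertible (2 : RatFunc F)] (Q : QuadraticForm (RatFunc F) W) : Prop :=
  (Q.baseChange (RatFunc.CompletionAtInfty F)).Anisotropic

/-- The representation number `R(L, Q, a) = #{v ∈ L : Q(v) = a}`. -/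
def repNumber (L : Submodule F[X] W) (Q : QuadraticForm (RatFunc F) W) (a : RatFunc F) : ℕ :=
  {v : W | v ∈ L ∧ Q v = a}.ncard

/-- `L_m = {v ∈ L : deg Q(v) ≤ m}`, with the convention `deg 0 = -∞`. -/
def filtration (L : Submodule F[X] W) (Q : QuadraticForm (RatFunc F) W) (m : ℤ) : Set W :=
  {v : W | v ∈ L ∧ (Q v = 0 ∨ (Q v).intDegree ≤ m)}

/-- The average `|L_m|⁻¹ ∑_{x ∈ L_m} χ_𝔭(Q(x))`. -/
def partialAverage (ξ : AlgebraicClosure F) (L : Submodule F[X] W)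
    (Q : QuadraticForm (RatFunc F) W) (m : ℤ) : ℂ :=
  ((filtration L Q m).ncard : ℂ)⁻¹ * ∑ᶠ x ∈ filtration L Q m, canonicalChar ξ (Q x)

/-- `μ(L, Q, χ_𝔭)`, the limit of the averages over `L_m` as `m → ∞`. -/
def average (ξ : AlgebraicClosure F) (L : Submodule F[X] W)
    (Q : QuadraticForm (RatFunc F) W) : ℂ :=
  limUnder atTop (partialAverage ξ L Q)

/-- The form `π⁻ᵏ Q`. -/
def scaledForm (π : F[X]) (k : ℤ) (Q : QuadraticForm (RatFunc F) W) :
    QuadraticForm (RatFunc F) W :=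
  (algebraMap F[X] (RatFunc F) π ^ (-k)) • Q

/-- `Q` takes `𝔭`-integral values on `L`. -/
def IsIntegralAt (𝔭 : HeightOneSpectrum F[X]) (L : Submodule F[X] W)
    (Q : QuadraticForm (RatFunc F) W) : Prop :=
  ∀ v ∈ L, 𝔭.valuation (RatFunc F) (Q v) ≤ 1

/-- The completion `L_𝔭`, as the `A_𝔭`-lattice generated by `L` in `W_𝔭 = K_𝔭 ⊗ W`. -/
def localLattice (𝔭 : HeightOneSpectrum F[X]) (L : Submodule F[X] W) :
    Submodule (𝔭.adicCompletionIntegers (RatFunc F))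
      (𝔭.adicCompletion (RatFunc F) ⊗[RatFunc F] W) :=
  Submodule.span _ ((fun w : W => (1 : 𝔭.adicCompletion (RatFunc F)) ⊗ₜ[RatFunc F] w) '' (L : Set W))

/-- The quadratic form on `L_𝔭` induced by `Q`, with values in `K_𝔭`. -/
def localForm [Invertible (2 : RatFunc F)] (𝔭 : HeightOneSpectrum F[X]) (L : Submodule F[X] W)
    (Q : QuadraticForm (RatFunc F) W) (x : localLattice 𝔭 L) : 𝔭.adicCompletion (RatFunc F) :=
  Q.baseChange (𝔭.adicCompletion (RatFunc F)) (x : 𝔭.adicCompletion (RatFunc F) ⊗[RatFunc F] W)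

end Global

/-- `(L_𝔭, Q)` and `(L'_𝔭, Q')` are isometric over `A_𝔭`. -/
def LocallyIsometric [Invertible (2 : RatFunc F)] (𝔭 : HeightOneSpectrum F[X])
    {W : Type*} [AddCommGroup W] [Module F[X] W] [Module (RatFunc F) W]
    {W' : Type*} [AddCommGroup W'] [Module F[X] W'] [Module (RatFunc F) W']
    (L : Submodule F[X] W) (Q : QuadraticForm (RatFunc F) W)
    (L' : Submodule F[X] W') (Q' : QuadraticForm (RatFunc F) W') : Prop :=
  ∃ e : localLattice 𝔭 L ≃ₗ[𝔭.adicCompletionIntegers (RatFunc F)] localLattice 𝔭 L',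
    ∀ x, localForm 𝔭 L' Q' (e x) = localForm 𝔭 L Q x

end Lattices

end

/-! Since `q` is odd, `L` contains orthogonal vectors `vᵢ` that generate it over the localization of
`A` at `π`, with `Q(vᵢ) = πᵉⁱ fᵢ` and `fᵢ` prime to `π` (`nonempty_jordanSplitting`). In the
resulting coordinates `π⁻ᵏQ` is diagonal, and `χ_𝔭(π⁻ᵏQ(x))` depends only on the `i`-th coordinates
modulo `π^max(k - eᵢ, 0)`.

Definiteness gives a Cauchy-Schwarz inequality at infinity
(`IsDefinite.inftyValuation_polar_sq_le`), which makes each `L_m` a finite group. For large `m` this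
group maps onto the finite group of reduced coordinates, so the average is exactly a product of
normalized quadratic Gauss sums of levels `max(k - eᵢ, 0)` (`eventually_partialAverage_eq`). That
representation numbers determine the averages is clear, because both `L_m` and the summand depend on
`x` only through `Q(x)`.

Conversely, a Gauss sum with unit coefficient is never zero, equals `1` at level `0`, has absolute
value less than `1` at positive level, and at level `1` changes sign with the square class of its
coefficient. Hence the product equals `1` exactly for `k ≤ min eᵢ`, which yields the least exponent;
the value at `k = min eᵢ + 1` yields the square class of the first unit; this nonzero factor is then
cancelled and one inducts on the rank (`jordan_invariants_eq`). Splittings are normalized so that,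
among equal exponents, only the last unit may be a nonsquare; this makes the invariants comparable
term by term. Equal invariants give an isometry, because units in one square class modulo `π` differ
by the square of a `𝔭`-adic unit (`exists_adicCompletion_sq_mul_eq`). -/

namespace Lattices

/-! ### Square roots of `1 + u` in completions -/

/-- In a complete valued field of odd characteristic, `1 + u` is a square when `v u < 1`. -/
theorem exists_sq_eq_one_add {R : Type*} [Field R] [Valued R (WithZero (Multiplicative ℤ))]
    [CompleteSpace R] (p : ℕ) [CharP R p] [Fact p.Prime] (hp : p ≠ 2) {u : R}
    (hu : Valued.v u < 1) : ∃ s : R, s ^ 2 = 1 + u := by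
  have hp1 : 1 < p := (Fact.out : p.Prime).one_lt
  obtain ⟨h, hh⟩ := (Fact.out : p.Prime).odd_of_ne_two hp
  -- Here `p = 2h + 1`, and the recursion gives `a M = (p^M + 1)/2`. By Frobenius the square of `(1
  -- + u)^(a M)` is `(1 + u)(1 + u^(p^M))`, which tends to `1 + u`, so the limit of these powers is
  -- a square root.
  let a : ℕ → ℕ := fun M => Nat.rec 1 (fun M b => b + p ^ M * h) M
  have ha0 : a 0 = 1 := rfl
  have ha1 : ∀ M, a (M + 1) = a M + p ^ M * h := fun _ => rfl
  have ha : ∀ M, 2 * a M = p ^ M + 1 := by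
    intro M
    induction M with
    | zero => simp [ha0]
    | succ M ih =>
      rw [ha1, mul_add, ih, pow_succ]
      nth_rw 4 [hh]
      ring
  have hpow : Tendsto (fun M : ℕ => u ^ (p ^ M)) atTop (nhds 0) :=
    (Valued.tendsto_zero_pow_of_v_lt_one hu).comp (tendsto_pow_atTop_atTop_of_one_lt hp1)
  have hv1 : Valued.v (1 + u) = (1 : WithZero (Multiplicative ℤ)) :=
    Valuation.map_one_add_of_lt _ hu
  have : NonarchimedeanAddGroup R := by
    refine ⟨fun U hU => ?_⟩
    obtain ⟨γ, hγ⟩ := Valued.mem_nhds_zero.1 hU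
    exact ⟨⟨Valued.v.restrict.ltAddSubgroup γ, AddSubgroup.isOpen_of_mem_nhds _ (g := 0)
      (Valued.mem_nhds_zero.2 ⟨γ, fun x hx => hx⟩)⟩, hγ⟩
  have hcs : CauchySeq (fun M => (1 + u) ^ a M) := by
    refine NonarchimedeanAddGroup.cauchySeq_of_tendsto_sub_nhds_zero ?_
    have h0 : Tendsto (fun M : ℕ => (1 + u ^ (p ^ M)) ^ h - 1) atTop (nhds 0) := by
      have := ((hpow.const_add 1).pow h).sub_const 1
      simpa using this
    rw [(Valued.hasBasis_nhds_zero R (WithZero (Multiplicative ℤ))).tendsto_right_iff] at h0 ⊢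
    intro γ hγ
    filter_upwards [h0 γ hγ] with M hM
    have e : (1 + u) ^ a (M + 1) - (1 + u) ^ a M
        = (1 + u) ^ a M * ((1 + u ^ (p ^ M)) ^ h - 1) := by
      have : 1 + u ^ (p ^ M) = (1 + u) ^ (p ^ M) := by
        rw [add_pow_char_pow, one_pow]
      rw [ha1, this, pow_add, pow_mul]
      ring
    change Valued.v.restrict _ < _ at hM
    change Valued.v.restrict _ < _
    rw [Valuation.restrict_lt_iff_lt_embedding] at hM ⊢
    rwa [e, map_mul, map_pow, hv1, one_pow, one_mul]
  obtain ⟨s, hs⟩ := cauchySeq_tendsto_of_complete hcs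
  refine ⟨s, tendsto_nhds_unique (hs.pow 2) ?_⟩
  have : (fun M => ((1 + u) ^ a M) ^ 2) = fun M => (1 + u) * (1 + u ^ (p ^ M)) := by
    funext M
    rw [← pow_mul, mul_comm, ha, pow_succ, add_pow_char_pow, one_pow, mul_comm]
  rw [this]
  simpa using (hpow.const_add 1).const_mul (1 + u)

section Infinity

variable {F : Type*} [Field F]

open Classical in
theorem valued_algebraMap_completionAtInfty (x : RatFunc F) :
    Valued.v (algebraMap (RatFunc F) (RatFunc.CompletionAtInfty F) x) =
      RatFunc.inftyValuation F x := by
  let := RatFunc.inftyValued F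
  exact Valued.valuedCompletion_apply x

open Classical in
theorem exists_sq_eq_one_add_completionAtInfty [Finite F] (hF : (2 : F) ≠ 0) {u : RatFunc F}
    (hu : RatFunc.inftyValuation F u < 1) :
    ∃ s : RatFunc.CompletionAtInfty F, s ^ 2 = algebraMap _ _ (1 + u) := by
  let := RatFunc.inftyValued F
  have : CompleteSpace (RatFunc.CompletionAtInfty F) :=
    inferInstanceAs (CompleteSpace (UniformSpace.Completion (RatFunc F)))
  let p := ringChar F
  have : Fact p.Prime := ⟨CharP.char_is_prime F p⟩
  have : CharP (RatFunc F) p := charP_of_injective_algebraMap (algebraMap F (RatFunc F)).injective p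
  have : CharP (RatFunc.CompletionAtInfty F) p :=
    charP_of_injective_algebraMap (algebraMap (RatFunc F) (RatFunc.CompletionAtInfty F)).injective p
  have hp : p ≠ 2 := by
    intro h
    apply hF
    have := CharP.cast_eq_zero F p
    rw [h] at this
    exact_mod_cast this
  obtain ⟨s, hs⟩ := exists_sq_eq_one_add p hp
    (u := algebraMap (RatFunc F) (RatFunc.CompletionAtInfty F) u)
    (by rwa [valued_algebraMap_completionAtInfty])
  exact ⟨s, by rw [hs, map_add, map_one]⟩

theorem exists_sq_eq_one_add_adicCompletion [Finite F] (hF : (2 : F) ≠ 0)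
    (𝔭 : HeightOneSpectrum F[X]) {u : RatFunc F} (hu : 𝔭.valuation (RatFunc F) u < 1) :
    ∃ s : 𝔭.adicCompletion (RatFunc F), s ^ 2 = algebraMap _ _ (1 + u) := by
  let p := ringChar F
  have : Fact p.Prime := ⟨CharP.char_is_prime F p⟩
  have : CharP (RatFunc F) p := charP_of_injective_algebraMap (algebraMap F (RatFunc F)).injective p
  have : CharP (𝔭.adicCompletion (RatFunc F)) p :=
    charP_of_injective_algebraMap
      (algebraMap (RatFunc F) (𝔭.adicCompletion (RatFunc F))).injective p
  have hp : p ≠ 2 := by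
    intro h
    apply hF
    have := CharP.cast_eq_zero F p
    rw [h] at this
    exact_mod_cast this
  obtain ⟨s, hs⟩ := exists_sq_eq_one_add p hp
    (u := algebraMap (RatFunc F) (𝔭.adicCompletion (RatFunc F)) u)
    (by
      rw [HeightOneSpectrum.algebraMap_adicCompletion]
      exact lt_of_eq_of_lt (HeightOneSpectrum.valuedAdicCompletion_eq_valuation' 𝔭 u) hu)
  exact ⟨s, by rw [hs, map_add, map_one]⟩

end Infinity

/-! ### Definite forms: Cauchy-Schwarz at infinity and finiteness of `L_m` -/

section Infinity

variable {F : Type*} [Field F]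

theorem two_ne_zero_of_invertible [Invertible (2 : RatFunc F)] : (2 : F) ≠ 0 := by
  intro h
  have := congrArg (algebraMap F (RatFunc F)) h
  simp only [map_ofNat, map_zero] at this
  exact Invertible.ne_zero (2 : RatFunc F) this

open Classical in
theorem inftyValuation_le_exp_iff (x : RatFunc F) (m : ℤ) :
    RatFunc.inftyValuation F x ≤ WithZero.exp m ↔ x = 0 ∨ x.intDegree ≤ m := by
  by_cases hx : x = 0
  · simp [hx]
  · rw [RatFunc.inftyValuation_apply, RatFunc.inftyValuation_of_nonzero F hx]
    simp [hx]

section General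

variable {W : Type*} [AddCommGroup W] [Module (RatFunc F) W]

theorem polar_baseChange_one_tmul [Invertible (2 : RatFunc F)] (R : Type*) [Field R]
    [Algebra (RatFunc F) R] (Q : QuadraticForm (RatFunc F) W) (x y : W) :
    QuadraticMap.polar (Q.baseChange R) ((1 : R) ⊗ₜ[RatFunc F] x) ((1 : R) ⊗ₜ[RatFunc F] y) =
      algebraMap (RatFunc F) R (QuadraticMap.polar Q x y) := by
  simp only [QuadraticMap.polar, ← TensorProduct.tmul_add, QuadraticForm.baseChange_tmul, map_sub,
    Algebra.smul_def, mul_one]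

open Classical in
/-- Cauchy-Schwarz for definite forms: otherwise a binary form would have square discriminant. -/
theorem IsDefinite.inftyValuation_polar_sq_le [Finite F] [Invertible (2 : RatFunc F)]
    {Q : QuadraticForm (RatFunc F) W} (hQ : IsDefinite Q) (x y : W) :
    RatFunc.inftyValuation F (QuadraticMap.polar Q x y) ^ 2 ≤
      RatFunc.inftyValuation F (Q x) * RatFunc.inftyValuation F (Q y) := by
  by_contra! hlt
  set R := RatFunc.CompletionAtInfty F
  set B := QuadraticMap.polar Q x y
  have h2 : (2 : RatFunc F) ≠ 0 := Invertible.ne_zero _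
  have hB : B ≠ 0 := by
    intro h
    simp [h] at hlt
  let ι := algebraMap (RatFunc F) R
  have hι : ∀ z, ι z = 0 ↔ z = 0 := fun z => map_eq_zero_iff ι ι.injective
  have hpol := polar_baseChange_one_tmul R Q x y
  have hQx : Q x ≠ 0 := by
    intro h
    have h0 : (1 : R) ⊗ₜ[RatFunc F] x = 0 := hQ _ (by simp [h])
    rw [h0, QuadraticMap.polar_zero_left] at hpol
    exact hB ((hι _).1 hpol.symm)
  have hv4 : RatFunc.inftyValuation F (4 : RatFunc F) ≤ 1 := by
    have := RatFunc.inftyValuation.C F (k := 4) (by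
      have := two_ne_zero_of_invertible (F := F)
      intro h
      apply this
      have h4 : (2 : F) * 2 = 0 := by rw [← h]; norm_num
      simpa using h4)
    rw [map_ofNat] at this
    exact this.le
  have hu : RatFunc.inftyValuation F (-(4 * (Q x * Q y) / B ^ 2)) < 1 := by
    rw [Valuation.map_neg, map_div₀, map_mul, map_mul, map_pow]
    rw [div_lt_one₀ (lt_of_le_of_lt zero_le hlt)]
    exact lt_of_le_of_lt (mul_le_of_le_one_left' hv4) hlt
  -- If `B²` dominates `Q(x)Q(y)`, then `B² - 4Q(x)Q(y) = B²(1 + u)` with `u` small, so the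
  -- discriminant of `Q(αx + y)`, as a polynomial in `α`, is the square `(sB)²` in `K_∞`.
  obtain ⟨s, hs⟩ := exists_sq_eq_one_add_completionAtInfty two_ne_zero_of_invertible hu
  have hs0 : s ≠ 0 := by
    rintro rfl
    rw [zero_pow two_ne_zero, eq_comm, hι] at hs
    have h1 := Valuation.map_one_add_of_lt _ hu
    rw [hs] at h1
    simp at h1
  have hQx' : ι (Q x) ≠ 0 := fun h => hQx ((hι _).1 h)
  have hB' : ι B ≠ 0 := fun h => hB ((hι _).1 h)
  have h2' : (2 : R) ≠ 0 := by
    rw [← map_ofNat ι 2]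
    exact fun h => h2 ((hι _).1 h)
  have hs' : s ^ 2 * (ι B) ^ 2 = (ι B) ^ 2 - 4 * (ι (Q x) * ι (Q y)) := by
    rw [hs]
    change ι _ * _ = _
    rw [map_add, map_neg, map_div₀, map_mul, map_mul, map_pow, map_one, map_ofNat ι]
    have e := div_mul_cancel₀ (4 * (ι (Q x) * ι (Q y))) (pow_ne_zero 2 hB')
    linear_combination -e
  let α : R := (-(ι B) + s * ι B) / (2 * ι (Q x))
  have hα : α * (2 * ι (Q x)) = -(ι B) + s * ι B := div_mul_cancel₀ _ (mul_ne_zero h2' hQx')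
  have hz : α • ((1 : R) ⊗ₜ[RatFunc F] x) + (1 : R) ⊗ₜ[RatFunc F] y = 0 := by
    apply hQ
    rw [QuadraticMap.map_add (Q.baseChange R), QuadraticMap.map_smul, QuadraticMap.polar_smul_left, hpol]
    simp only [QuadraticForm.baseChange_tmul, Algebra.smul_def, mul_one]
    change α * α * ι (Q x) + ι (Q y) + α * ι B = 0
    have h4 : (4 * ι (Q x)) * (α * α * ι (Q x) + ι (Q y) + α * ι B) = 0 := by
      have : (4 * ι (Q x)) * (α * α * ι (Q x) + ι (Q y) + α * ι B) =
          (α * (2 * ι (Q x)) + ι B) ^ 2 - ((ι B) ^ 2 - 4 * (ι (Q x) * ι (Q y))) := by ring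
      rw [this, hα, ← hs']
      ring
    have h4' : (4 : R) ≠ 0 := by
      have : (4 : R) = 2 * 2 := by norm_num
      rw [this]
      exact mul_ne_zero h2' h2'
    exact (mul_eq_zero.1 h4).resolve_left (mul_ne_zero h4' hQx')
  -- Vanishing of `αx + y` is not yet absurd, since `x` and `y` may be dependent. Pairing it with
  -- `x` gives `2αQ(x) + B = sB = 0`, which is.
  have hp := QuadraticMap.polar_add_left (Q.baseChange R) (α • ((1 : R) ⊗ₜ[RatFunc F] x))
    ((1 : R) ⊗ₜ[RatFunc F] y) ((1 : R) ⊗ₜ[RatFunc F] x)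
  rw [hz, QuadraticMap.polar_zero_left, QuadraticMap.polar_smul_left, QuadraticMap.polar_self,
    QuadraticMap.polar_comm _ _ ((1 : R) ⊗ₜ[RatFunc F] x), hpol] at hp
  rw [QuadraticForm.baseChange_tmul, smul_eq_mul, nsmul_eq_mul, Nat.cast_ofNat, mul_one,
    Algebra.smul_def (Q x), mul_one] at hp
  change 0 = α * (2 * ι (Q x)) + ι B at hp
  rw [hα] at hp
  have : s * ι B = 0 := by linear_combination -hp
  exact mul_ne_zero hs0 hB' this

theorem IsDefinite.anisotropic [Finite F] [Invertible (2 : RatFunc F)]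
    {Q : QuadraticForm (RatFunc F) W} (hQ : IsDefinite Q) : Q.Anisotropic := by
  classical
  intro x hx
  have h0 : (1 : RatFunc.CompletionAtInfty F) ⊗ₜ[RatFunc F] x = 0 := hQ _ (by simp [hx])
  exact (Module.FaithfullyFlat.one_tmul_eq_zero_iff (RatFunc F) W _).1 h0

end General

theorem finite_setOf_natDegree_le [Finite F] (n : ℕ) : {f : F[X] | f.natDegree ≤ n}.Finite := by
  have : Finite (Polynomial.degreeLT F (n + 1)) :=
    Finite.of_equiv _ (Polynomial.degreeLTEquiv F (n + 1)).toEquiv.symm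
  refine (Set.toFinite (Polynomial.degreeLT F (n + 1) : Set F[X])).subset fun f hf => ?_
  rw [SetLike.mem_coe, Polynomial.mem_degreeLT]
  exact lt_of_le_of_lt Polynomial.degree_le_natDegree
    (by exact_mod_cast Nat.lt_succ_of_le hf)

/-- A finitely generated submodule of `F(t)` is discrete at infinity. -/
theorem finite_setOf_intDegree_le [Finite F] (M : Submodule F[X] (RatFunc F)) (hM : M.FG) (m : ℤ) :
    {z : RatFunc F | z ∈ M ∧ (z = 0 ∨ z.intDegree ≤ m)}.Finite := by
  obtain ⟨d, hd, hdM⟩ := FractionalIdeal.isFractional_of_fg (S := nonZeroDivisors F[X]) hM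
  have hd0 : d ≠ 0 := nonZeroDivisors.ne_zero hd
  have hd0' : algebraMap F[X] (RatFunc F) d ≠ 0 := by simpa using hd0
  refine ((finite_setOf_natDegree_le (F := F) (m + d.natDegree).toNat).image
    (fun f => algebraMap F[X] (RatFunc F) f / algebraMap F[X] (RatFunc F) d)).subset ?_
  rintro z ⟨hz, hm⟩
  obtain ⟨f, hf⟩ := hdM z hz
  rw [Algebra.smul_def] at hf
  refine ⟨f, ?_, ?_⟩
  · rcases hm with rfl | hm
    · have : f = 0 := by simpa using hf
      simp [this]
    · by_cases hz0 : z = 0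
      · have : f = 0 := by simpa [hz0] using hf
        simp [this]
      · have := congrArg RatFunc.intDegree hf
        rw [RatFunc.intDegree_mul hd0' hz0, RatFunc.intDegree_polynomial,
          RatFunc.intDegree_polynomial] at this
        change f.natDegree ≤ _
        omega
  · change _ / _ = _
    rw [hf, mul_div_cancel_left₀ _ hd0']

variable {W : Type*} [AddCommGroup W] [Module F[X] W] [Module (RatFunc F) W]
  [IsScalarTower F[X] (RatFunc F) W]

omit [IsScalarTower F[X] (RatFunc F) W] in
open Classical in
theorem mem_filtration_iff (L : Submodule F[X] W) (Q : QuadraticForm (RatFunc F) W) (m : ℤ)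
    (x : W) : x ∈ filtration L Q m ↔
      x ∈ L ∧ RatFunc.inftyValuation F (Q x) ≤ WithZero.exp m := by
  rw [inftyValuation_le_exp_iff]
  rfl

/-- The steps of the filtration of a definite lattice are additive groups. -/
def filtrationSubgroup [Finite F] [Invertible (2 : RatFunc F)] (L : Submodule F[X] W)
    (Q : QuadraticForm (RatFunc F) W) (hQ : IsDefinite Q) (m : ℤ) : AddSubgroup W where
  carrier := filtration L Q m
  zero_mem' := ⟨L.zero_mem, Or.inl (map_zero Q)⟩
  neg_mem' := by
    rintro x ⟨hx, h⟩
    exact ⟨L.neg_mem hx, by rwa [QuadraticMap.map_neg]⟩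
  add_mem' := by
    classical
    intro x y hx hy
    rw [mem_filtration_iff] at hx hy ⊢
    refine ⟨L.add_mem hx.1 hy.1, ?_⟩
    rw [QuadraticMap.map_add Q]
    refine Valuation.map_add_le _ (Valuation.map_add_le _ hx.2 hy.2) ?_
    have h := (hQ.inftyValuation_polar_sq_le x y).trans (mul_le_mul' hx.2 hy.2)
    rw [← sq] at h
    exact le_of_pow_le_pow_left₀ two_ne_zero zero_le h

/-- By Cauchy-Schwarz the pairings of a vector of `L_m` with finitely many generators of `L` have
bounded degree. They lie in finitely generated submodules of `K`, so they take finitely many values;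
by anisotropy they determine the vector. -/
theorem finite_filtration [Finite F] [Invertible (2 : RatFunc F)] (L : Submodule F[X] W)
    (hL : Submodule.IsLattice (RatFunc F) L)
    (Q : QuadraticForm (RatFunc F) W) (hQ : IsDefinite Q) (m : ℤ) : (filtration L Q m).Finite := by
  classical
  obtain ⟨S, hS⟩ := hL.fg
  let φ : W → W →ₗ[F[X]] RatFunc F := fun s =>
    (QuadraticMap.polarBilin Q s).restrictScalars F[X]
  have hfin : ∀ s : W, {z : RatFunc F | z ∈ L.map (φ s) ∧
      (z = 0 ∨ z.intDegree ≤ max m (Q s).intDegree)}.Finite := fun s =>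
    finite_setOf_intDegree_le _ (hL.fg.map _) _
  refine Set.Finite.of_finite_image (f := fun x (s : S) => φ s x)
    ((Set.Finite.pi (fun s : S => hfin s)).subset ?_) ?_
  · rintro _ ⟨x, hx, rfl⟩ s -
    refine ⟨Submodule.mem_map_of_mem hx.1, ?_⟩
    rw [← inftyValuation_le_exp_iff]
    rw [mem_filtration_iff] at hx
    refine le_of_pow_le_pow_left₀ two_ne_zero zero_le
      ((hQ.inftyValuation_polar_sq_le (s : W) x).trans ?_)
    rw [sq]
    refine mul_le_mul' ?_ (hx.2.trans (by simp))
    rw [inftyValuation_le_exp_iff]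
    exact Or.inr (le_max_right _ _)
  · intro x _ y _ hxy
    rw [← sub_eq_zero]
    apply hQ.anisotropic
    have h : ∀ z : W, QuadraticMap.polarBilin Q z (x - y) = 0 := by
      intro z
      have hz : z ∈ Submodule.span (RatFunc F) (S : Set W) := by
        have h1 := hL.span_eq_top
        have h2 : (L : Set W) ⊆ Submodule.span (RatFunc F) (S : Set W) := by
          rw [← hS]
          exact Submodule.span_subset_span F[X] (RatFunc F) (S : Set W)
        have := Submodule.span_le.2 h2
        rw [h1] at this
        exact this trivial
      induction hz using Submodule.span_induction with
      | mem s hs =>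
        have := congrFun hxy ⟨s, hs⟩
        rw [map_sub, sub_eq_zero]
        exact this
      | zero => simp
      | add a b _ _ ha hb => rw [map_add, LinearMap.add_apply, ha, hb, add_zero]
      | smul c a _ ha => rw [map_smul, LinearMap.smul_apply, ha, smul_zero]
    have := h (x - y)
    rw [QuadraticMap.polarBilin_apply_apply, QuadraticMap.polar_self, nsmul_eq_mul,
      Nat.cast_ofNat] at this
    exact (mul_eq_zero.1 this).resolve_left (Invertible.ne_zero _)

omit [IsScalarTower F[X] (RatFunc F) W] in
theorem filtration_scaledForm (L : Submodule F[X] W) (Q : QuadraticForm (RatFunc F) W) {π : F[X]}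
    (hπ : π ≠ 0) (k m : ℤ) : filtration L (scaledForm π k Q) m =
      filtration L Q (m + k * π.natDegree) := by
  classical
  have hπ' : algebraMap F[X] (RatFunc F) π ≠ 0 := by simpa using hπ
  ext x
  rw [mem_filtration_iff, mem_filtration_iff]
  refine and_congr_right fun _ => ?_
  have : scaledForm π k Q x = algebraMap F[X] (RatFunc F) π ^ (-k) * Q x := rfl
  rw [this, map_mul, map_zpow₀, RatFunc.inftyValuation_apply, RatFunc.inftyValuation.polynomial F hπ,
    ← WithZero.exp_zsmul]
  rw [← mul_le_mul_iff_right₀ (a := (WithZero.exp (k * (π.natDegree : ℤ)))) (by simp), ← mul_assoc,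
    ← WithZero.exp_add, ← WithZero.exp_add]
  simp [add_comm]

end Infinity

/-! ### The residue character and its primitivity modulo `πʲ` -/

section Character

variable {F : Type*} [Field F]

theorem traceChar_eq (κ : Type*) [Field κ] [NeZero (ringChar κ)] (x : κ) :
    letI : Algebra (ZMod (ringChar κ)) κ := ZMod.algebra κ (ringChar κ)
    traceChar κ x = ZMod.stdAddChar (Algebra.trace (ZMod (ringChar κ)) κ x) := by
  let : Algebra (ZMod (ringChar κ)) κ := ZMod.algebra κ (ringChar κ)
  rw [ZMod.stdAddChar_apply, ZMod.toCircle_apply]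
  rfl

theorem traceChar_add (κ : Type*) [Field κ] [NeZero (ringChar κ)] (x y : κ) :
    traceChar κ (x + y) = traceChar κ x * traceChar κ y := by
  simp only [traceChar_eq, map_add, AddChar.map_add_eq_mul]

theorem traceChar_zero (κ : Type*) [Field κ] [NeZero (ringChar κ)] : traceChar κ 0 = 1 := by
  simp only [traceChar_eq, map_zero, AddChar.map_zero_eq_one]

theorem exists_traceChar_ne_one (κ : Type*) [Field κ] [Finite κ] : ∃ x, traceChar κ x ≠ 1 := by
  have : Fact (ringChar κ).Prime := ⟨CharP.char_is_prime κ _⟩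
  let : Algebra (ZMod (ringChar κ)) κ := ZMod.algebra κ (ringChar κ)
  have h := Algebra.trace_ne_zero (ZMod (ringChar κ)) κ
  obtain ⟨x, hx⟩ := DFunLike.ne_iff.1 h
  refine ⟨x, fun h1 => hx ?_⟩
  rw [traceChar_eq] at h1
  exact ZMod.injective_stdAddChar (h1.trans (AddChar.map_zero_eq_one _).symm)

/-- Polynomials in `T`, as Laurent series. -/
noncomputable def polyToLaurent (E : Type*) [Field E] : E[X] →+* LaurentSeries E :=
  (HahnSeries.ofPowerSeries ℤ E).comp Polynomial.coeToPowerSeries.ringHom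

theorem polyToLaurent_injective (E : Type*) [Field E] : Function.Injective (polyToLaurent E) :=
  HahnSeries.ofPowerSeries_injective.comp (Polynomial.coe_injective E)

variable (ξ : AlgebraicClosure F)

theorem eval₂_eq_polyToLaurent (g : F[X]) :
    g.eval₂ ((HahnSeries.C : _ →+* LaurentSeries (IntermediateField.adjoin F {ξ})).comp
      (algebraMap F (IntermediateField.adjoin F {ξ})))
      (HahnSeries.C (IntermediateField.AdjoinSimple.gen F ξ) + HahnSeries.single 1 1) =
    polyToLaurent _ (taylor (IntermediateField.AdjoinSimple.gen F ξ)
      (g.map (algebraMap F (IntermediateField.adjoin F {ξ})))) := by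
  set E := IntermediateField.adjoin F {ξ}
  have hC : ∀ e : E, polyToLaurent E (C e) = HahnSeries.C e := by
    intro e
    simp [polyToLaurent]
  have hX : polyToLaurent E X = HahnSeries.single 1 1 := by
    simp [polyToLaurent]
  rw [taylor_apply, Polynomial.comp, Polynomial.eval₂_map, Polynomial.hom_eval₂, map_add, hC, hX,
    add_comm]
  congr 1
  ext a : 1
  exact (hC _).symm

/-- `RatFunc.eval` respects sums and products only if denominators do not evaluate to zero; this is
what makes `laurentExpansion` additive and multiplicative. -/
theorem eval₂_gen_add_single_ne_zero {g : F[X]} (hg : g ≠ 0) :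
    g.eval₂ ((HahnSeries.C : _ →+* LaurentSeries (IntermediateField.adjoin F {ξ})).comp
      (algebraMap F (IntermediateField.adjoin F {ξ})))
      (HahnSeries.C (IntermediateField.AdjoinSimple.gen F ξ) + HahnSeries.single 1 1) ≠ 0 := by
  rw [eval₂_eq_polyToLaurent]
  intro h
  rw [map_eq_zero_iff _ (polyToLaurent_injective _)] at h
  have := (map_eq_zero_iff (taylor _) (taylor_injective _)).1 h
  exact hg ((Polynomial.map_eq_zero _).1 this)

theorem laurentExpansion_add (f g : RatFunc F) :
    laurentExpansion ξ (f + g) = laurentExpansion ξ f + laurentExpansion ξ g :=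
  RatFunc.eval_add _ _ (eval₂_gen_add_single_ne_zero ξ f.denom_ne_zero)
    (eval₂_gen_add_single_ne_zero ξ g.denom_ne_zero)

theorem laurentExpansion_mul (f g : RatFunc F) :
    laurentExpansion ξ (f * g) = laurentExpansion ξ f * laurentExpansion ξ g :=
  RatFunc.eval_mul _ _ (eval₂_gen_add_single_ne_zero ξ f.denom_ne_zero)
    (eval₂_gen_add_single_ne_zero ξ g.denom_ne_zero)

theorem laurentExpansion_algebraMap (g : F[X]) :
    laurentExpansion ξ (algebraMap F[X] (RatFunc F) g) =
      polyToLaurent _ (taylor (IntermediateField.AdjoinSimple.gen F ξ)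
        (g.map (algebraMap F (IntermediateField.adjoin F {ξ})))) := by
  rw [← eval₂_eq_polyToLaurent]
  exact RatFunc.eval_algebraMap _ _ g

theorem residue_algebraMap (g : F[X]) : residue ξ (algebraMap F[X] (RatFunc F) g) = 0 := by
  rw [residue, laurentExpansion_algebraMap]
  exact (PowerSeries.coeff_coe _ _).trans (if_pos (by norm_num))

/-- At a simple zero of `π`, the residue of `a / π` is `a(ξ) / π'(ξ)`. -/
theorem residue_div_mul (a π : F[X]) (hπ : aeval ξ π = 0)
    (hπ' : aeval (IntermediateField.AdjoinSimple.gen F ξ) (derivative π) ≠ 0) :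
    residue ξ (algebraMap F[X] (RatFunc F) a / algebraMap F[X] (RatFunc F) π) *
      aeval (IntermediateField.AdjoinSimple.gen F ξ) (derivative π) =
      aeval (IntermediateField.AdjoinSimple.gen F ξ) a := by
  set E := IntermediateField.adjoin F {ξ}
  set γ := IntermediateField.AdjoinSimple.gen F ξ
  have hπ0 : π ≠ 0 := by
    rintro rfl
    simp at hπ'
  have hγ : aeval γ π = 0 := by
    apply (algebraMap E (AlgebraicClosure F)).injective
    rw [← Polynomial.aeval_algebraMap_apply, map_zero]
    exact hπ
  set P := taylor γ (π.map (algebraMap F E)) with hP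
  set N := taylor γ (a.map (algebraMap F E)) with hN
  have hP0 : P.coeff 0 = 0 := by
    rw [hP, taylor_coeff_zero, eval_map_algebraMap, hγ]
  have hP1 : P.coeff 1 = aeval γ (derivative π) := by
    rw [hP, taylor_coeff_one, derivative_map, eval_map_algebraMap]
  have hN0 : N.coeff 0 = aeval γ a := by
    rw [hN, taylor_coeff_zero, eval_map_algebraMap]
  -- The zero of `π` at `ξ` is simple: its Taylor polynomial is `T·U` with `U(0) = π'(ξ) ≠ 0`. So
  -- `U` is an invertible power series and `a/π` is `T⁻¹` times a power series.
  obtain ⟨U, hU⟩ := Polynomial.X_dvd_iff.2 hP0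
  have hU0 : U.coeff 0 = P.coeff 1 := by rw [hU, coeff_X_mul]
  let V : PowerSeries E := (U : PowerSeries E)
  have hV : PowerSeries.constantCoeff V ≠ 0 := by
    change PowerSeries.constantCoeff (U : PowerSeries E) ≠ 0
    rw [← PowerSeries.coeff_zero_eq_constantCoeff_apply, Polynomial.coeff_coe, hU0, hP1]
    exact hπ'
  have hX : polyToLaurent E X = HahnSeries.single 1 1 := by
    simp [polyToLaurent]
  have hmul : laurentExpansion ξ (algebraMap F[X] (RatFunc F) a / algebraMap F[X] (RatFunc F) π) *
      polyToLaurent E P = polyToLaurent E N := by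
    rw [hP, ← laurentExpansion_algebraMap, ← laurentExpansion_mul, div_mul_cancel₀ _ (by simpa),
      laurentExpansion_algebraMap]
  have hexp : laurentExpansion ξ (algebraMap F[X] (RatFunc F) a / algebraMap F[X] (RatFunc F) π) =
      HahnSeries.single (-1) 1 * HahnSeries.ofPowerSeries ℤ E ((N : PowerSeries E) * V⁻¹) := by
    have hPne : polyToLaurent E P ≠ 0 := by
      rw [Ne, map_eq_zero_iff _ (polyToLaurent_injective _)]
      intro h
      rw [h, coeff_zero] at hP1
      exact hπ' hP1.symm
    apply mul_right_cancel₀ hPne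
    rw [hmul, hU, map_mul (polyToLaurent E), hX]
    have h1 : polyToLaurent E U = HahnSeries.ofPowerSeries ℤ E V := rfl
    have h2 : (HahnSeries.single (-1) 1 * HahnSeries.single 1 1 : LaurentSeries E) = 1 := by
      rw [HahnSeries.single_mul_single]
      simp
    rw [h1, mul_comm (HahnSeries.single 1 1 : LaurentSeries E), ← mul_assoc,
      mul_assoc (HahnSeries.single (-1) 1 : LaurentSeries E), ← map_mul, mul_assoc _ V⁻¹,
      mul_comm V⁻¹, PowerSeries.mul_inv_cancel V hV, mul_one, mul_right_comm, h2, one_mul]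
    rfl
  have hres : residue ξ (algebraMap F[X] (RatFunc F) a / algebraMap F[X] (RatFunc F) π) =
      PowerSeries.constantCoeff ((N : PowerSeries E) * V⁻¹) := by
    rw [residue, hexp, ← PowerSeries.coeff_zero_eq_constantCoeff_apply,
      ← LaurentSeries.coeff_coe_powerSeries]
    have := HahnSeries.coeff_single_mul_add (r := (1 : E)) (a := (0 : ℤ)) (b := -1)
      (x := HahnSeries.ofPowerSeries ℤ E ((N : PowerSeries E) * V⁻¹))
    simpa using this
  rw [hres, map_mul, PowerSeries.constantCoeff_inv, ← hP1, ← hU0, ← hN0]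
  have e1 : PowerSeries.constantCoeff V = U.coeff 0 := by
    rw [← PowerSeries.coeff_zero_eq_constantCoeff_apply, Polynomial.coeff_coe]
  have e2 : PowerSeries.constantCoeff (N : PowerSeries E) = N.coeff 0 := by
    rw [← PowerSeries.coeff_zero_eq_constantCoeff_apply, Polynomial.coeff_coe]
  rw [e1] at hV
  rw [e1, e2, mul_assoc, inv_mul_cancel₀ hV, mul_one]

variable [Finite F]

instance finite_adjoin_simple : Finite (IntermediateField.adjoin F {ξ}) := by
  have : FiniteDimensional F (IntermediateField.adjoin F {ξ}) :=
    IntermediateField.adjoin.finiteDimensional (Algebra.IsIntegral.isIntegral ξ)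
  exact Module.finite_of_finite F

instance neZero_ringChar_of_finite (κ : Type*) [Field κ] [Finite κ] : NeZero (ringChar κ) :=
  ⟨(CharP.char_is_prime κ (ringChar κ)).ne_zero⟩

theorem canonicalChar_add (f g : RatFunc F) :
    canonicalChar ξ (f + g) = canonicalChar ξ f * canonicalChar ξ g := by
  rw [canonicalChar, residue, laurentExpansion_add, HahnSeries.coeff_add]
  exact traceChar_add _ _ _

theorem canonicalChar_algebraMap (g : F[X]) :
    canonicalChar ξ (algebraMap F[X] (RatFunc F) g) = 1 := by
  rw [canonicalChar, residue_algebraMap, traceChar_zero]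

/-- `π` is separable because `F` is perfect, so the residue of `a/π` is `a(ξ)/π'(ξ)`. As `a` varies
these residues fill `F(ξ)`, on which the trace character is nontrivial. -/
theorem exists_canonicalChar_div_ne_one {π : F[X]} (hirr : Irreducible π) (hπ : aeval ξ π = 0) :
    ∃ a : F[X], canonicalChar ξ (algebraMap F[X] (RatFunc F) a / algebraMap F[X] (RatFunc F) π)
      ≠ 1 := by
  set E := IntermediateField.adjoin F {ξ}
  set γ := IntermediateField.AdjoinSimple.gen F ξ
  have hγ : aeval γ π = 0 := by
    apply (algebraMap E (AlgebraicClosure F)).injective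
    rw [← Polynomial.aeval_algebraMap_apply, map_zero]
    exact hπ
  have hd : aeval γ (derivative π) ≠ 0 :=
    (PerfectField.separable_of_irreducible hirr).aeval_derivative_ne_zero hγ
  obtain ⟨c, hc⟩ := exists_traceChar_ne_one E
  obtain ⟨a, ha⟩ := (IntermediateField.adjoin.powerBasis
    (Algebra.IsIntegral.isIntegral (R := F) ξ)).exists_eq_aeval' (c * aeval γ (derivative π))
  rw [IntermediateField.adjoin.powerBasis_gen] at ha
  refine ⟨a, ?_⟩
  rw [canonicalChar]
  have h := residue_div_mul ξ a π hπ hd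
  change _ = aeval γ a at h
  rw [← ha] at h
  rwa [mul_right_cancel₀ hd h]

theorem canonicalChar_div_congr {d a b : F[X]} (hd : d ≠ 0) (h : d ∣ a - b) :
    canonicalChar ξ (algebraMap F[X] (RatFunc F) a / algebraMap F[X] (RatFunc F) d) =
      canonicalChar ξ (algebraMap F[X] (RatFunc F) b / algebraMap F[X] (RatFunc F) d) := by
  obtain ⟨c, hc⟩ := h
  have hd' : algebraMap F[X] (RatFunc F) d ≠ 0 := by simpa using hd
  have : algebraMap F[X] (RatFunc F) a / algebraMap F[X] (RatFunc F) d =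
      algebraMap F[X] (RatFunc F) b / algebraMap F[X] (RatFunc F) d +
        algebraMap F[X] (RatFunc F) c := by
    rw [eq_add_of_sub_eq hc, map_add, map_mul]
    field_simp
    ring
  rw [this, canonicalChar_add, canonicalChar_algebraMap, mul_one]

/-- The character `y ↦ χ_𝔭(y / d)` of `A / d`. -/
noncomputable def levelChar {d : F[X]} (hd : d ≠ 0) : AddChar (F[X] ⧸ Ideal.span {d}) ℂ where
  toFun y := canonicalChar ξ (algebraMap F[X] (RatFunc F) (Quotient.out y) /
    algebraMap F[X] (RatFunc F) d)
  map_zero_eq_one' := by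
    rw [canonicalChar_div_congr ξ hd (b := 0), map_zero, zero_div, ← map_zero (algebraMap F[X] _),
      canonicalChar_algebraMap]
    rw [← Ideal.mem_span_singleton, ← Ideal.Quotient.eq, map_zero]
    exact Ideal.Quotient.mk_out _
  map_add_eq_mul' x y := by
    rw [← canonicalChar_add, ← add_div, ← map_add]
    refine canonicalChar_div_congr ξ hd ?_
    rw [← Ideal.mem_span_singleton, ← Ideal.Quotient.eq, map_add]
    exact (Ideal.Quotient.mk_out _).trans
      (congrArg₂ _ (Ideal.Quotient.mk_out _) (Ideal.Quotient.mk_out _)).symm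

theorem levelChar_mk {d : F[X]} (hd : d ≠ 0) (a : F[X]) :
    levelChar ξ hd (Ideal.Quotient.mk _ a) =
      canonicalChar ξ (algebraMap F[X] (RatFunc F) a / algebraMap F[X] (RatFunc F) d) := by
  refine canonicalChar_div_congr ξ hd ?_
  rw [← Ideal.mem_span_singleton, ← Ideal.Quotient.eq]
  exact Ideal.Quotient.mk_out _

/-- The character of level `πʲ` is primitive. -/
theorem dvd_of_forall_canonicalChar_eq_one {π : F[X]} (hirr : Irreducible π) (hπ : aeval ξ π = 0)
    (j : ℕ) (h : F[X]) (hh : ∀ y : F[X], canonicalChar ξ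
      (algebraMap F[X] (RatFunc F) (h * y) / algebraMap F[X] (RatFunc F) (π ^ j)) = 1) :
    π ^ j ∣ h := by
  by_contra hndvd
  have hmax : ∃ i < j, π ^ i ∣ h ∧ ¬ π ^ (i + 1) ∣ h := by
    by_contra! hc
    apply hndvd
    have : ∀ i ≤ j, π ^ i ∣ h := by
      intro i
      induction i with
      | zero => simp
      | succ i ih => exact fun hi => hc i (by omega) (ih (by omega))
    exact this j le_rfl
  obtain ⟨i, hij, ⟨g, hg⟩, hi⟩ := hmax
  have hπg : ¬ π ∣ g := by
    rintro ⟨c, rfl⟩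
    exact hi ⟨c, by rw [hg]; ring⟩
  obtain ⟨a, ha⟩ := exists_canonicalChar_div_ne_one ξ hirr hπ
  obtain ⟨u, v, huv⟩ := (hirr.coprime_iff_not_dvd.2 hπg)
  apply ha
  -- With `h = πⁱg` and `v` an inverse of `g` modulo `π`, this multiplier turns `hy/πʲ` into
  -- `vga/π`, which is congruent to `a/π` modulo polynomials.
  have h1 := hh (π ^ (j - 1 - i) * (v * a))
  have hπ0 : algebraMap F[X] (RatFunc F) π ≠ 0 := by simpa using hirr.ne_zero
  have e : algebraMap F[X] (RatFunc F) (h * (π ^ (j - 1 - i) * (v * a))) /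
      algebraMap F[X] (RatFunc F) (π ^ j) =
      algebraMap F[X] (RatFunc F) (v * g * a) / algebraMap F[X] (RatFunc F) π := by
    have : π ^ j = π ^ i * π ^ (j - 1 - i) * π := by
      rw [← pow_add, ← pow_succ]
      congr 1
      omega
    rw [this, hg]
    simp only [map_mul, map_pow]
    field_simp
  rw [e] at h1
  rw [← h1]
  refine canonicalChar_div_congr ξ hirr.ne_zero ⟨u * a, ?_⟩
  linear_combination (-a) * huv

theorem levelChar_isPrimitive {π : F[X]} (hirr : Irreducible π) (hπ : aeval ξ π = 0) (j : ℕ) :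
    (levelChar ξ (pow_ne_zero j hirr.ne_zero)).IsPrimitive := by
  intro x hx h
  obtain ⟨a, rfl⟩ := Ideal.Quotient.mk_surjective x
  apply hx
  rw [Ideal.Quotient.eq_zero_iff_mem, Ideal.mem_span_singleton]
  refine dvd_of_forall_canonicalChar_eq_one ξ hirr hπ j a fun y => ?_
  rw [← levelChar_mk ξ (pow_ne_zero j hirr.ne_zero), map_mul, ← AddChar.mulShift_apply, h,
    AddChar.one_apply]

end Character

/-! ### Quadratic Gauss sums over finite rings -/

section QuadraticMean

/-- The normalized quadratic Gauss sum `|R|⁻¹ ∑ ψ(f y²)`. -/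
noncomputable def quadMean {R : Type*} [CommRing R] (ψ : AddChar R ℂ) (f : R) : ℂ :=
  (Nat.card R : ℂ)⁻¹ * ∑ᶠ y : R, ψ (f * y ^ 2)

/-- In the double sum of `ψ(f(x² - y²))` put `x = y + h`. The exponent becomes `fh² + 2fhy`, linear
in `y`, and by primitivity the sum over `y` vanishes unless `2fh = 0`, that is `h = 0`. -/
theorem norm_sum_sq_of_isPrimitive {R : Type*} [CommRing R] [Fintype R] {ψ : AddChar R ℂ}
    (hψ : ψ.IsPrimitive) {f : R} (hf : IsUnit f) (h2 : IsUnit (2 : R)) :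
    ‖∑ y, ψ (f * y ^ 2)‖ ^ 2 = Fintype.card R := by
  classical
  rw [← Complex.ofReal_inj, ← Complex.normSq_eq_norm_sq, ← Complex.mul_conj, map_sum,
    Finset.sum_mul_sum, Finset.sum_comm]
  have h1 : ∀ y : R, ∑ x, ψ (f * x ^ 2) * (starRingEnd ℂ) (ψ (f * y ^ 2)) =
      ∑ h, ψ (f * h ^ 2) * ψ (y * (2 * f * h)) := by
    intro y
    refine (Fintype.sum_equiv (Equiv.addRight y) _ _ fun h => ?_).symm
    rw [← AddChar.map_neg_eq_conj, ← AddChar.map_add_eq_mul, ← AddChar.map_add_eq_mul,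
      Equiv.coe_addRight]
    congr 1
    ring
  simp_rw [h1]
  rw [Finset.sum_comm]
  simp_rw [← Finset.mul_sum, AddChar.sum_mulShift _ hψ]
  have h3 : ∀ h : R, 2 * f * h = 0 ↔ h = 0 := fun h => (h2.mul hf).mul_right_eq_zero
  simp [h3]

theorem norm_quadMean_sq {R : Type*} [CommRing R] [Finite R] {ψ : AddChar R ℂ}
    (hψ : ψ.IsPrimitive) {f : R} (hf : IsUnit f) (h2 : IsUnit (2 : R)) :
    ‖quadMean ψ f‖ ^ 2 = (Nat.card R : ℝ)⁻¹ := by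
  have := Fintype.ofFinite R
  have h0 : (Fintype.card R : ℝ) ≠ 0 := by exact_mod_cast Fintype.card_ne_zero
  rw [quadMean, finsum_eq_sum_of_fintype, norm_mul, mul_pow, norm_sum_sq_of_isPrimitive hψ hf h2,
    Nat.card_eq_fintype_card, norm_inv, Complex.norm_natCast]
  field_simp

theorem quadMean_mul_sq {R : Type*} [CommRing R] (ψ : AddChar R ℂ) (f : R) (s : Rˣ) :
    quadMean ψ (f * s ^ 2) = quadMean ψ f := by
  rw [quadMean, quadMean, ← finsum_comp_equiv s.mulLeft (f := fun y => ψ (f * y ^ 2))]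
  congr 2
  funext y
  rw [Units.mulLeft_apply]
  congr 1
  ring

/-- Let `χ` be the quadratic character. The value `w` is taken by `gy²` exactly `1 + χ(g)χ(w)`
times. Since `χ(f') = -χ(f)`, adding the two sums leaves `2∑ψ(w) = 0`. -/
theorem quadMean_eq_neg {κ : Type*} [Field κ] [Finite κ] {ψ : AddChar κ ℂ} (hψ : ψ.IsPrimitive)
    (h2 : ringChar κ ≠ 2) {f f' : κ} (hff : ¬ IsSquare (f * f')) :
    quadMean ψ f' = -quadMean ψ f := by
  classical
  have := Fintype.ofFinite κ
  have hf : f ≠ 0 := by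
    rintro rfl
    simp at hff
  have hf' : f' ≠ 0 := by
    rintro rfl
    simp at hff
  have key : ∀ g : κ, g ≠ 0 → ∑ y, ψ (g * y ^ 2) =
      ∑ w, ((quadraticChar κ g * quadraticChar κ w + 1 : ℤ) : ℂ) * ψ w := by
    intro g hg
    rw [← Finset.sum_fiberwise Finset.univ (fun y : κ => g * y ^ 2)]
    refine Finset.sum_congr rfl fun w _ => ?_
    have h1 : ∑ y with g * y ^ 2 = w, ψ (g * y ^ 2) = ∑ y with g * y ^ 2 = w, ψ w :=
      Finset.sum_congr rfl fun y hy => by rw [(Finset.mem_filter.1 hy).2]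
    rw [h1, Finset.sum_const, nsmul_eq_mul]
    congr 1
    have h3 : (Finset.univ.filter fun y : κ => g * y ^ 2 = w) =
        {x : κ | x ^ 2 = g⁻¹ * w}.toFinset := by
      ext y
      rw [Finset.mem_filter, Set.mem_toFinset]
      change _ ∧ _ ↔ y ^ 2 = g⁻¹ * w
      rw [eq_inv_mul_iff_mul_eq₀ hg]
      simp
    have h4 := quadraticChar_card_sqrts h2 (g⁻¹ * w)
    have h5 : quadraticChar κ (g⁻¹ * w) = quadraticChar κ g * quadraticChar κ w := by
      have : g⁻¹ * w = g * w * (g⁻¹) ^ 2 := by field_simp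
      rw [this, map_mul, map_mul, quadraticChar_sq_one' (inv_ne_zero hg), mul_one]
    rw [h3, ← h5, ← h4]
    norm_cast
  have hq : quadraticChar κ f' = -quadraticChar κ f := by
    have h6 := quadraticChar_neg_one_iff_not_isSquare.2 hff
    rw [map_mul] at h6
    rcases quadraticChar_dichotomy hf with h | h <;> rw [h] at h6 ⊢ <;> linarith
  have hone : ψ ≠ 1 := by
    have := hψ (one_ne_zero)
    rwa [AddChar.mulShift_one] at this
  rw [quadMean, quadMean, finsum_eq_sum_of_fintype, finsum_eq_sum_of_fintype, key f hf, key f' hf',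
    hq, ← mul_neg]
  congr 1
  rw [eq_neg_iff_add_eq_zero, ← Finset.sum_add_distrib]
  have : ∀ w, ((-quadraticChar κ f * quadraticChar κ w + 1 : ℤ) : ℂ) * ψ w +
      ((quadraticChar κ f * quadraticChar κ w + 1 : ℤ) : ℂ) * ψ w = 2 * ψ w := by
    intro w
    push_cast
    ring
  rw [Finset.sum_congr rfl fun w _ => this w, ← Finset.mul_sum, AddChar.sum_eq_zero_of_ne_one hone,
    mul_zero]

theorem exists_eq_mul_units_sq {R : Type*} [CommRing R] {u : Rˣ} {f f' z : R} (hu : (u : R) = f)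
    (hz : IsUnit z) (h : z ^ 2 = u * f') : ∃ s : Rˣ, f' = f * (s : R) ^ 2 := by
  obtain ⟨z, rfl⟩ := hz
  refine ⟨u⁻¹ * z, ?_⟩
  rw [← hu, Units.val_mul, mul_pow, h, sq, mul_assoc, ← mul_assoc _ (u : R), Units.inv_mul, one_mul,
    ← mul_assoc, Units.mul_inv, one_mul]

/-- If `nᵐ = 0`, then `(1 + n)^(p^m) = 1` by Frobenius. As `p^m` is odd, the power of exponent `(p^m
+ 1)/2` is a square root. -/
theorem isSquare_one_add_of_isNilpotent {R : Type*} [CommRing R] (p : ℕ) [CharP R p]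
    [Fact p.Prime] (hp : p ≠ 2) {n : R} (hn : IsNilpotent n) : IsSquare (1 + n) := by
  obtain ⟨m, hm⟩ := hn
  have h1 : (1 + n) ^ p ^ m = 1 := by
    rw [add_pow_char_pow, one_pow,
      pow_eq_zero_of_le (Nat.lt_pow_self (Fact.out : p.Prime).one_lt).le hm, add_zero]
  obtain ⟨h, hh⟩ := ((Fact.out : p.Prime).odd_of_ne_two hp).pow (n := m)
  refine ⟨(1 + n) ^ (h + 1), ?_⟩
  rw [← pow_add, show h + 1 + (h + 1) = p ^ m + 1 by omega, pow_succ, h1, one_mul]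

end QuadraticMean

/-! ### Gauss sums modulo `πʲ` -/

section Level

variable {F : Type*} [Field F]

/-- `f` is a square modulo `π`. -/
def IsSquareMod (π f : F[X]) : Prop := ∃ c, π ∣ f - c ^ 2

theorem finite_quotient_span_singleton [Finite F] {d : F[X]} (hd : d ≠ 0) :
    Finite (F[X] ⧸ Ideal.span {d}) := by
  have : Module.Finite F (AdjoinRoot d) := (AdjoinRoot.powerBasis hd).finite
  exact Module.finite_of_finite F (M := AdjoinRoot d)

theorem isUnit_mk_of_not_dvd {π f : F[X]} (hirr : Irreducible π) (hf : ¬ π ∣ f) (j : ℕ) :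
    IsUnit (Ideal.Quotient.mk (Ideal.span {π ^ j}) f) := by
  obtain ⟨u, v, huv⟩ := ((hirr.coprime_iff_not_dvd.2 hf).pow_left (m := j))
  refine IsUnit.of_mul_eq_one (Ideal.Quotient.mk _ v) ?_
  rw [← map_mul, ← map_one (Ideal.Quotient.mk _), Ideal.Quotient.eq, Ideal.mem_span_singleton]
  exact ⟨-u, by linear_combination huv⟩

theorem isUnit_two_quotient (h2 : (2 : F) ≠ 0) (I : Ideal F[X]) : IsUnit (2 : F[X] ⧸ I) := by
  have h := (IsUnit.mk0 _ h2).map ((Ideal.Quotient.mk I).comp Polynomial.C)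
  rwa [map_ofNat] at h

/-- Hensel: units with the same square class modulo `π` have the same square class
modulo `πʲ`. -/
theorem exists_mk_eq_mul_sq [Finite F] (h2 : (2 : F) ≠ 0) {π f f' : F[X]} (hirr : Irreducible π)
    (hf : ¬ π ∣ f) (hf' : ¬ π ∣ f') (hff : IsSquareMod π (f * f')) (j : ℕ) :
    ∃ s : (F[X] ⧸ Ideal.span {π ^ j})ˣ,
      Ideal.Quotient.mk (Ideal.span {π ^ j}) f' =
        Ideal.Quotient.mk (Ideal.span {π ^ j}) f * (s : F[X] ⧸ Ideal.span {π ^ j}) ^ 2 := by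
  rcases Nat.eq_zero_or_pos j with rfl | hj
  · have : Subsingleton (F[X] ⧸ Ideal.span {π ^ 0}) := by
      rw [pow_zero, Ideal.Quotient.subsingleton_iff, Ideal.span_singleton_one]
    exact ⟨1, Subsingleton.elim _ _⟩
  · have hπj : ¬ IsUnit (π ^ j) := fun h => hirr.not_isUnit ((isUnit_pow_iff hj.ne').1 h)
    have : Nontrivial (F[X] ⧸ Ideal.span {π ^ j}) :=
      Ideal.Quotient.nontrivial_iff.2 (by rwa [Ne, Ideal.span_singleton_eq_top])
    let p := ringChar F
    have : Fact p.Prime := ⟨CharP.char_is_prime F p⟩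
    have : CharP (F[X] ⧸ Ideal.span {π ^ j}) p :=
      charP_of_injective_ringHom ((Ideal.Quotient.mk (Ideal.span {π ^ j})).comp C).injective p
    have hp : p ≠ 2 := by
      intro h
      apply h2
      have := CharP.cast_eq_zero F p
      rw [h] at this
      exact_mod_cast this
    set mk := Ideal.Quotient.mk (Ideal.span {π ^ j})
    obtain ⟨c, t, hc⟩ := hff
    obtain ⟨u, hu⟩ := isUnit_mk_of_not_dvd hirr hf j
    obtain ⟨u', hu'⟩ := isUnit_mk_of_not_dvd hirr hf' j
    change _ = mk f at hu
    change _ = mk f' at hu'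
    have hc0 : ¬ π ∣ c := by
      intro h
      have h3 : π ∣ f * f' := by
        rw [eq_add_of_sub_eq hc]
        exact dvd_add (dvd_mul_right _ _) (dvd_pow h two_ne_zero)
      exact (hirr.prime.dvd_or_dvd h3).elim hf hf'
    obtain ⟨d, hd⟩ := isUnit_mk_of_not_dvd hirr hc0 j
    change _ = mk c at hd
    -- From `ff' = c² + πt` one gets `ff' = c²(1 + πt/c²)`, where the second factor is `1` plus a
    -- nilpotent.
    have hnil : IsNilpotent (mk (π * t) * ((d⁻¹ : _ˣ) : F[X] ⧸ Ideal.span {π ^ j}) ^ 2) := by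
      refine ⟨j, ?_⟩
      have : mk π ^ j = 0 := by
        rw [← map_pow]
        exact Ideal.Quotient.eq_zero_iff_mem.2 (Ideal.mem_span_singleton_self _)
      rw [map_mul, mul_pow, mul_pow, this, zero_mul, zero_mul]
    obtain ⟨r, hr⟩ := isSquare_one_add_of_isNilpotent p hp hnil
    have hrd : (r * d) ^ 2 = (u : F[X] ⧸ Ideal.span {π ^ j}) * u' := by
      have e1 : mk f * mk f' = mk (π * t) + mk c ^ 2 := by
        rw [← map_mul, ← map_pow, ← map_add, eq_add_of_sub_eq hc]
      rw [hu, hu', e1, mul_pow, sq r, ← hr, ← hd]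
      rw [add_mul, one_mul, mul_assoc, ← mul_pow, Units.inv_mul, one_pow, mul_one, add_comm]
    have hru : IsUnit (r * (d : F[X] ⧸ Ideal.span {π ^ j})) :=
      (isUnit_pow_iff two_ne_zero).1 (by rw [hrd]; exact u.isUnit.mul u'.isUnit)
    exact exists_eq_mul_units_sq hu hru (by rw [hrd, ← hu'])

variable (ξ : AlgebraicClosure F) [Finite F]

/-- The mean of `χ_𝔭(π⁻ʲ f y²)` over `y` modulo `πʲ`. -/
noncomputable def levelMean {π : F[X]} (hπ : π ≠ 0) (j : ℕ) (f : F[X]) : ℂ :=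
  quadMean (levelChar ξ (pow_ne_zero j hπ)) (Ideal.Quotient.mk _ f)

variable {ξ} {π : F[X]} (hirr : Irreducible π)

/-- Level `0` is the trivial ring. This matches the truncation in `(k - e).toNat`: terms with `k ≤
e` contribute the factor `1`. -/
theorem levelMean_zero (f : F[X]) : levelMean ξ hirr.ne_zero 0 f = 1 := by
  have : Subsingleton (F[X] ⧸ Ideal.span {π ^ 0}) := by
    rw [pow_zero, Ideal.Quotient.subsingleton_iff, Ideal.span_singleton_one]
  have : Unique (F[X] ⧸ Ideal.span {π ^ 0}) := uniqueOfSubsingleton 0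
  rw [levelMean, quadMean, finsum_unique, Nat.card_unique, Nat.cast_one, inv_one, one_mul,
    Subsingleton.elim (_ * _) (0 : F[X] ⧸ Ideal.span {π ^ 0}), AddChar.map_zero_eq_one]

variable (hξ : aeval ξ π = 0) (h2 : (2 : F) ≠ 0)
include hξ h2

theorem norm_levelMean_sq {f : F[X]} (hf : ¬ π ∣ f) (j : ℕ) :
    ‖levelMean ξ hirr.ne_zero j f‖ ^ 2 = (Nat.card (F[X] ⧸ Ideal.span {π ^ j}) : ℝ)⁻¹ := by
  have := finite_quotient_span_singleton (pow_ne_zero j hirr.ne_zero)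
  exact norm_quadMean_sq (levelChar_isPrimitive ξ hirr hξ j) (isUnit_mk_of_not_dvd hirr hf j)
    (isUnit_two_quotient h2 _)

theorem levelMean_ne_zero {f : F[X]} (hf : ¬ π ∣ f) (j : ℕ) :
    levelMean ξ hirr.ne_zero j f ≠ 0 := by
  have := finite_quotient_span_singleton (pow_ne_zero j hirr.ne_zero)
  intro h
  have h1 := norm_levelMean_sq hirr hξ h2 hf j
  rw [h, norm_zero, zero_pow two_ne_zero, eq_comm, inv_eq_zero, Nat.cast_eq_zero] at h1
  exact Nat.card_pos.ne' h1

theorem norm_levelMean_lt_one {f : F[X]} (hf : ¬ π ∣ f) {j : ℕ} (hj : 0 < j) :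
    ‖levelMean ξ hirr.ne_zero j f‖ < 1 := by
  have := finite_quotient_span_singleton (pow_ne_zero j hirr.ne_zero)
  have hπj : ¬ IsUnit (π ^ j) := fun h => hirr.not_isUnit ((isUnit_pow_iff hj.ne').1 h)
  have : Nontrivial (F[X] ⧸ Ideal.span {π ^ j}) :=
    Ideal.Quotient.nontrivial_iff.2 (by rwa [Ne, Ideal.span_singleton_eq_top])
  rw [← sq_lt_one_iff₀ (norm_nonneg _), norm_levelMean_sq hirr hξ h2 hf]
  exact inv_lt_one_of_one_lt₀ (by exact_mod_cast Finite.one_lt_card)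

omit hξ in
theorem levelMean_congr {f f' : F[X]} (hf : ¬ π ∣ f) (hf' : ¬ π ∣ f')
    (hff : IsSquareMod π (f * f')) (j : ℕ) :
    levelMean ξ hirr.ne_zero j f = levelMean ξ hirr.ne_zero j f' := by
  obtain ⟨s, hs⟩ := exists_mk_eq_mul_sq h2 hirr hf hf' hff j
  rw [levelMean, levelMean, hs, quadMean_mul_sq]

theorem levelMean_one_eq_neg {f f' : F[X]} (hff : ¬ IsSquareMod π (f * f')) :
    levelMean ξ hirr.ne_zero 1 f' = -levelMean ξ hirr.ne_zero 1 f := by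
  have := finite_quotient_span_singleton (pow_ne_zero 1 hirr.ne_zero)
  have hmax : (Ideal.span {π ^ 1}).IsMaximal := by
    rw [pow_one]
    exact PrincipalIdealRing.isMaximal_of_irreducible hirr
  let := Ideal.Quotient.field (Ideal.span {π ^ 1})
  refine quadMean_eq_neg (levelChar_isPrimitive ξ hirr hξ 1) ?_ ?_
  · intro h
    have h3 := (isUnit_two_quotient h2 (Ideal.span {π ^ 1})).ne_zero
    apply h3
    have := ringChar.Nat.cast_ringChar (R := F[X] ⧸ Ideal.span {π ^ 1})
    rw [h] at this
    exact_mod_cast this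
  · rintro ⟨r, hr⟩
    obtain ⟨c, rfl⟩ := Ideal.Quotient.mk_surjective r
    refine hff ⟨c, ?_⟩
    rw [← map_mul, ← map_mul, Ideal.Quotient.eq, Ideal.mem_span_singleton, pow_one, ← sq] at hr
    exact hr

end Level

/-! ### Square classes modulo `π` -/

section SquareClasses

variable {F : Type*} [Field F] [Finite F] {π : F[X]}

omit [Finite F] in
theorem isSquareMod_iff_isSquare_mk (f : F[X]) :
    IsSquareMod π f ↔ IsSquare (Ideal.Quotient.mk (Ideal.span {π}) f) := by
  constructor
  · rintro ⟨c, hc⟩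
    refine ⟨Ideal.Quotient.mk _ c, ?_⟩
    rwa [← map_mul, Ideal.Quotient.eq, Ideal.mem_span_singleton, ← sq]
  · rintro ⟨r, hr⟩
    obtain ⟨c, rfl⟩ := Ideal.Quotient.mk_surjective r
    refine ⟨c, ?_⟩
    rwa [← map_mul, Ideal.Quotient.eq, Ideal.mem_span_singleton, ← sq] at hr

/-- There are two square classes of units modulo `π`. -/
theorem isSquareMod_mul_iff (hirr : Irreducible π) {f f' : F[X]} (hf : ¬ π ∣ f) (hf' : ¬ π ∣ f') :
    IsSquareMod π (f * f') ↔ (IsSquareMod π f ↔ IsSquareMod π f') := by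
  classical
  have := finite_quotient_span_singleton hirr.ne_zero
  have hmax : (Ideal.span {π}).IsMaximal := PrincipalIdealRing.isMaximal_of_irreducible hirr
  let := Ideal.Quotient.field (Ideal.span {π})
  let := Fintype.ofFinite (F[X] ⧸ Ideal.span {π})
  have h0 : ∀ {g : F[X]}, ¬ π ∣ g → Ideal.Quotient.mk (Ideal.span {π}) g ≠ 0 := by
    intro g hg h
    exact hg (Ideal.mem_span_singleton.1 (Ideal.Quotient.eq_zero_iff_mem.1 h))
  simp only [isSquareMod_iff_isSquare_mk, map_mul]
  rw [← quadraticChar_one_iff_isSquare (h0 hf), ← quadraticChar_one_iff_isSquare (h0 hf'),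
    ← quadraticChar_one_iff_isSquare (mul_ne_zero (h0 hf) (h0 hf')), map_mul]
  rcases quadraticChar_dichotomy (h0 hf) with h | h <;>
  rcases quadraticChar_dichotomy (h0 hf') with h' | h' <;> rw [h, h'] <;> norm_num

/-- A nondegenerate binary form over a finite field of odd characteristic represents `1`. This lets
two vectors of equal order be combined into one whose unit part is a square. -/
theorem exists_isSquareMod_of_sum (hirr : Irreducible π) (h2 : (2 : F) ≠ 0) {f f' : F[X]}
    (hf : ¬ π ∣ f) (hf' : ¬ π ∣ f') : ∃ a b : F[X], π ∣ f * a ^ 2 + f' * b ^ 2 - 1 := by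
  classical
  have := finite_quotient_span_singleton hirr.ne_zero
  have hmax : (Ideal.span {π}).IsMaximal := PrincipalIdealRing.isMaximal_of_irreducible hirr
  let := Ideal.Quotient.field (Ideal.span {π})
  let := Fintype.ofFinite (F[X] ⧸ Ideal.span {π})
  have h0 : ∀ {g : F[X]}, ¬ π ∣ g → Ideal.Quotient.mk (Ideal.span {π}) g ≠ 0 := by
    intro g hg h
    exact hg (Ideal.mem_span_singleton.1 (Ideal.Quotient.eq_zero_iff_mem.1 h))
  have hchar : ringChar (F[X] ⧸ Ideal.span {π}) ≠ 2 := by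
    intro h
    have h3 := (isUnit_two_quotient h2 (Ideal.span {π})).ne_zero
    apply h3
    have := ringChar.Nat.cast_ringChar (R := F[X] ⧸ Ideal.span {π})
    rw [h] at this
    exact_mod_cast this
  set u := Ideal.Quotient.mk (Ideal.span {π}) f
  set u' := Ideal.Quotient.mk (Ideal.span {π}) f'
  have hd1 : (C u * X ^ 2 : (F[X] ⧸ Ideal.span {π})[X]).degree = 2 := by
    simpa using degree_C_mul_X_pow 2 (h0 hf)
  have hd2 : (C u' * X ^ 2 - C 1 : (F[X] ⧸ Ideal.span {π})[X]).degree = 2 := by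
    have h1 : (C u' * X ^ 2 : (F[X] ⧸ Ideal.span {π})[X]).degree = 2 := by
      simpa using degree_C_mul_X_pow 2 (h0 hf')
    rw [degree_sub_C (by rw [h1]; norm_num), h1]
  have hodd : Fintype.card (F[X] ⧸ Ideal.span {π}) % 2 = 1 :=
    FiniteField.odd_card_of_char_ne_two hchar
  obtain ⟨r, s, hrs⟩ := FiniteField.exists_root_sum_quadratic hd1 hd2 hodd
  obtain ⟨a, rfl⟩ := Ideal.Quotient.mk_surjective r
  obtain ⟨b, rfl⟩ := Ideal.Quotient.mk_surjective s
  refine ⟨a, b, ?_⟩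
  rw [← Ideal.mem_span_singleton, ← Ideal.Quotient.eq_zero_iff_mem]
  simp only [map_sub, map_add, map_mul, map_pow, map_one]
  simpa [add_sub_assoc] using hrs

end SquareClasses

/-! ### Recovering the Jordan invariants from products of Gauss sums -/

section Recover

theorem norm_prod_lt_one {ι : Type*} {s : Finset ι} {z : ι → ℂ} (h : ∀ i ∈ s, ‖z i‖ ≤ 1) {i : ι}
    (hi : i ∈ s) (hlt : ‖z i‖ < 1) : ‖∏ i ∈ s, z i‖ < 1 := by
  classical
  rw [← Finset.mul_prod_erase s z hi, norm_mul, norm_prod]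
  refine lt_of_le_of_lt (mul_le_of_le_one_right (norm_nonneg _) ?_) hlt
  exact Finset.prod_le_one (fun _ _ => norm_nonneg _) fun j hj => h j (Finset.mem_of_mem_erase hj)

variable {F : Type*} [Field F] [Finite F] {ξ : AlgebraicClosure F} {π : F[X]}
  (hirr : Irreducible π) (hξ : aeval ξ π = 0) (h2 : (2 : F) ≠ 0)
include hξ h2

/-- Factors with `k ≤ eᵢ` are `1` and all others have norm less than `1`. The product therefore
decides whether `k` is at most every exponent. -/
theorem levelMean_prod_dichotomy {n : ℕ} (e : Fin n → ℤ) (f : Fin n → F[X])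
    (hf : ∀ i, ¬ π ∣ f i) (k : ℤ) :
    ((∀ i, k ≤ e i) ∧ ∏ i, levelMean ξ hirr.ne_zero (k - e i).toNat (f i) = 1) ∨
    ((¬ ∀ i, k ≤ e i) ∧ ‖∏ i, levelMean ξ hirr.ne_zero (k - e i).toNat (f i)‖ < 1) := by
  have h1 : ∀ i, k ≤ e i → levelMean ξ hirr.ne_zero (k - e i).toNat (f i) = 1 := by
    intro i hi
    rw [Int.toNat_of_nonpos (by omega), levelMean_zero hirr]
  have h3 : ∀ i, ¬ k ≤ e i → ‖levelMean ξ hirr.ne_zero (k - e i).toNat (f i)‖ < 1 := fun i hi =>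
    norm_levelMean_lt_one hirr hξ h2 (hf i) (by omega)
  by_cases h : ∀ i, k ≤ e i
  · exact Or.inl ⟨h, Finset.prod_eq_one fun i _ => h1 i (h i)⟩
  · refine Or.inr ⟨h, ?_⟩
    push Not at h
    obtain ⟨i, hi⟩ := h
    refine norm_prod_lt_one (fun j _ => ?_) (Finset.mem_univ i) (h3 i (by omega))
    by_cases hj : k ≤ e j
    · rw [h1 j hj, norm_one]
    · exact (h3 j hj).le

theorem forall_le_iff_of_levelMean_prod_eq {n n' : ℕ} {e : Fin n → ℤ} {f : Fin n → F[X]}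
    {e' : Fin n' → ℤ} {f' : Fin n' → F[X]} (hf : ∀ i, ¬ π ∣ f i) (hf' : ∀ i, ¬ π ∣ f' i) {k : ℤ}
    (h : ∏ i, levelMean ξ hirr.ne_zero (k - e i).toNat (f i) =
      ∏ i, levelMean ξ hirr.ne_zero (k - e' i).toNat (f' i)) :
    (∀ i, k ≤ e i) ↔ (∀ i, k ≤ e' i) := by
  rcases levelMean_prod_dichotomy hirr hξ h2 e f hf k with ⟨ha, hb⟩ | ⟨ha, hb⟩ <;>
  rcases levelMean_prod_dichotomy hirr hξ h2 e' f' hf' k with ⟨ha', hb'⟩ | ⟨ha', hb'⟩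
  · exact iff_of_true ha ha'
  · rw [← h, hb, norm_one] at hb'
    exact absurd hb' (lt_irrefl _)
  · rw [h, hb', norm_one] at hb
    exact absurd hb (lt_irrefl _)
  · exact iff_of_false ha ha'

/-- The means of `π⁻ᵏ ∑ πᵉⁱ fᵢ xᵢ²`, for `k ≥ k₀`, determine the Jordan invariants. -/
theorem jordan_invariants_eq (k₀ : ℤ) (n n' : ℕ) (e : Fin n → ℤ) (f : Fin n → F[X])
    (e' : Fin n' → ℤ) (f' : Fin n' → F[X])
    (hf : ∀ i, ¬ π ∣ f i) (hf' : ∀ i, ¬ π ∣ f' i)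
    (hs : ∀ i j, i < j → e i < e j ∨ (e i = e j ∧ IsSquareMod π (f i)))
    (hs' : ∀ i j, i < j → e' i < e' j ∨ (e' i = e' j ∧ IsSquareMod π (f' i)))
    (hk₀ : ∀ i, k₀ ≤ e i)
    (h : ∀ k ≥ k₀, ∏ i, levelMean ξ hirr.ne_zero (k - e i).toNat (f i) =
      ∏ i, levelMean ξ hirr.ne_zero (k - e' i).toNat (f' i)) :
    ∃ hn : n = n', ∀ i, e i = e' (Fin.cast hn i) ∧ IsSquareMod π (f i * f' (Fin.cast hn i)) := by
  have hiff : ∀ k ≥ k₀, (∀ i, k ≤ e i) ↔ (∀ i, k ≤ e' i) := fun k hk =>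
    forall_le_iff_of_levelMean_prod_eq hirr hξ h2 hf hf' (h k hk)
  induction n generalizing n' with
  | zero =>
    cases n' with
    | zero => exact ⟨rfl, fun i => i.elim0⟩
    | succ n' =>
      -- The empty side satisfies every bound vacuously, while the other fails at any `k > e' 0`;
      -- the maximum keeps `k` in the range of the hypothesis.
      have := (hiff (max k₀ (e' 0 + 1)) (le_max_left _ _)).1 (fun i => i.elim0) 0
      omega
  | succ n ih =>
    cases n' with
    | zero =>
      have := (hiff (max k₀ (e 0 + 1)) (le_max_left _ _)).2 (fun i => i.elim0) 0
      omega
    | succ n' =>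
      have hmin : ∀ i, e 0 ≤ e i := by
        intro i
        rcases (Fin.zero_le i).eq_or_lt with rfl | hi
        · exact le_rfl
        · rcases hs 0 i hi with h1 | h1 <;> omega
      have hmin' : ∀ i, e' 0 ≤ e' i := by
        intro i
        rcases (Fin.zero_le i).eq_or_lt with rfl | hi
        · exact le_rfl
        · rcases hs' 0 i hi with h1 | h1 <;> omega
      -- The bound `k₀` is assumed for `e` only: comparing at `k = e 0` first puts `e' 0` in the
      -- admissible range, after which the comparison can be reversed.
      have h01 : e 0 ≤ e' 0 := (hiff (e 0) (hk₀ 0)).1 hmin 0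
      have h10 : e' 0 ≤ e 0 := (hiff (e' 0) ((hk₀ 0).trans h01)).2 hmin' 0
      have he : e 0 = e' 0 := le_antisymm h01 h10
      have hsq : IsSquareMod π (f 0 * f' 0) := by
        by_contra hns
        -- One step above the least exponent both first factors have level `1`. If the square
        -- classes differed they would be opposite, and so would be the products over the remaining
        -- indices.
        have hk := h (e 0 + 1) (by have := hk₀ 0; omega)
        rw [Fin.prod_univ_succ, Fin.prod_univ_succ, ← he, show (e 0 + 1 - e 0).toNat = 1 by omega,
          levelMean_one_eq_neg hirr hξ h2 hns] at hk
        have hm0 := levelMean_ne_zero hirr hξ h2 (hf 0) 1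
        have d := levelMean_prod_dichotomy hirr hξ h2 (fun i => e (Fin.succ i))
          (fun i => f (Fin.succ i)) (fun i => hf _) (e 0 + 1)
        have d' := levelMean_prod_dichotomy hirr hξ h2 (fun i => e' (Fin.succ i))
          (fun i => f' (Fin.succ i)) (fun i => hf' _) (e 0 + 1)
        have hT : ∏ i : Fin n, levelMean ξ hirr.ne_zero (e 0 + 1 - e i.succ).toNat (f i.succ) =
            -∏ i : Fin n', levelMean ξ hirr.ne_zero (e 0 + 1 - e' i.succ).toNat (f' i.succ) := by
          apply mul_left_cancel₀ hm0
          rw [hk]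
          ring
        -- If both lowest blocks had rank at least two, `sorted` would make both first units
        -- squares. So one tail product is `1`, and the other would have to be `-1`, whereas it is
        -- `1` or of norm less than `1`.
        have hor : (∀ i : Fin n, e 0 + 1 ≤ e i.succ) ∨ (∀ i : Fin n', e 0 + 1 ≤ e' i.succ) := by
          by_contra hc
          push Not at hc
          obtain ⟨⟨i, hi⟩, ⟨j, hj⟩⟩ := hc
          have hi' := hs 0 i.succ (Fin.succ_pos i)
          have hj' := hs' 0 j.succ (Fin.succ_pos j)
          apply hns
          rw [isSquareMod_mul_iff hirr (hf 0) (hf' 0)]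
          refine iff_of_true (hi'.resolve_left (by omega)).2 (hj'.resolve_left (by omega)).2
        rcases d with ⟨a, b⟩ | ⟨a, b⟩ <;> rcases d' with ⟨a', b'⟩ | ⟨a', b'⟩
        · rw [b, b'] at hT
          norm_num at hT
        · rw [← norm_neg, ← hT, b, norm_one] at b'
          exact lt_irrefl _ b'
        · rw [hT, norm_neg, b', norm_one] at b
          exact lt_irrefl _ b
        · exact hor.elim a a'
      have htail : ∀ k ≥ k₀,
          ∏ i : Fin n, levelMean ξ hirr.ne_zero (k - e i.succ).toNat (f i.succ) =
          ∏ i : Fin n', levelMean ξ hirr.ne_zero (k - e' i.succ).toNat (f' i.succ) := by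
        intro k hk
        have h1 := h k hk
        rw [Fin.prod_univ_succ, Fin.prod_univ_succ, ← he,
          ← levelMean_congr hirr h2 (hf 0) (hf' 0) hsq] at h1
        exact mul_left_cancel₀ (levelMean_ne_zero hirr hξ h2 (hf 0) _) h1
      obtain ⟨rfl, hn⟩ := ih n' (fun i => e i.succ) (fun i => f i.succ) (fun i => e' i.succ)
        (fun i => f' i.succ) (fun i => hf _) (fun i => hf' _)
        (fun i j hij => hs _ _ (Fin.succ_lt_succ_iff.2 hij))
        (fun i j hij => hs' _ _ (Fin.succ_lt_succ_iff.2 hij)) (fun i => hk₀ _) htail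
        (fun k hk => forall_le_iff_of_levelMean_prod_eq hirr hξ h2 (fun i => hf _) (fun i => hf' _)
          (htail k hk))
      refine ⟨rfl, fun i => ?_⟩
      refine Fin.cases ⟨he, hsq⟩ (fun i => hn i) i

end Recover

/-! ### The localization at `π` and its reductions -/

section LocalRing

variable {F : Type*} [Field F] {π : F[X]}

/-- The localization of `F[t]` at `π`, inside `F(t)`. -/
def localSubring (hirr : Irreducible π) : Subring (RatFunc F) where
  carrier := {a | ∃ s c : F[X], ¬ π ∣ s ∧
    algebraMap F[X] (RatFunc F) s * a = algebraMap F[X] (RatFunc F) c}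
  zero_mem' := ⟨1, 0, fun h => hirr.not_isUnit (isUnit_of_dvd_one h), by simp⟩
  one_mem' := ⟨1, 1, fun h => hirr.not_isUnit (isUnit_of_dvd_one h), by simp⟩
  add_mem' := by
    rintro a b ⟨s, c, hs, h⟩ ⟨s', c', hs', h'⟩
    refine ⟨s * s', s' * c + s * c', fun hd => (hirr.prime.dvd_or_dvd hd).elim hs hs', ?_⟩
    simp only [map_mul, map_add, ← h, ← h']
    ring
  mul_mem' := by
    rintro a b ⟨s, c, hs, h⟩ ⟨s', c', hs', h'⟩
    refine ⟨s * s', c * c', fun hd => (hirr.prime.dvd_or_dvd hd).elim hs hs', ?_⟩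
    simp only [map_mul, ← h, ← h']
    ring
  neg_mem' := by
    rintro a ⟨s, c, hs, h⟩
    exact ⟨s, -c, hs, by simp [← h]⟩

variable (hirr : Irreducible π)

theorem algebraMap_mem_localSubring (c : F[X]) :
    algebraMap F[X] (RatFunc F) c ∈ localSubring hirr :=
  ⟨1, c, fun h => hirr.not_isUnit (isUnit_of_dvd_one h), by simp⟩

theorem algebraMap_ne_zero_of_not_dvd {s : F[X]} (hs : ¬ π ∣ s) :
    algebraMap F[X] (RatFunc F) s ≠ 0 := by
  rw [Ne, map_eq_zero_iff _ (IsFractionRing.injective F[X] (RatFunc F))]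
  rintro rfl
  exact hs (dvd_zero π)

theorem inv_mem_localSubring {s : F[X]} (hs : ¬ π ∣ s) :
    (algebraMap F[X] (RatFunc F) s)⁻¹ ∈ localSubring hirr :=
  ⟨s, 1, hs, by rw [mul_inv_cancel₀ (algebraMap_ne_zero_of_not_dvd hs), map_one]⟩

/-- A denominator prime to `π` does not vanish at `ξ`, so the expansion there is a power series and
the residue is zero. -/
theorem canonicalChar_eq_one_of_mem [Finite F] {ξ : AlgebraicClosure F} (hξ : aeval ξ π = 0)
    {a : RatFunc F} (ha : a ∈ localSubring hirr) : canonicalChar ξ a = 1 := by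
  obtain ⟨s, c, hs, h⟩ := ha
  set E := IntermediateField.adjoin F {ξ}
  set γ := IntermediateField.AdjoinSimple.gen F ξ
  have hsξ : aeval γ s ≠ 0 := by
    intro h0
    have h1 : aeval ξ s = 0 := by
      have := congrArg (algebraMap E (AlgebraicClosure F)) h0
      rwa [← Polynomial.aeval_algebraMap_apply, map_zero] at this
    obtain ⟨u, v, huv⟩ := hirr.coprime_iff_not_dvd.2 hs
    have := congrArg (aeval ξ) huv
    simp [h1, hξ] at this
  set P := taylor γ (s.map (algebraMap F E)) with hP
  have hP0 : P.coeff 0 = aeval γ s := by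
    rw [hP, taylor_coeff_zero, eval_map_algebraMap]
  let V : PowerSeries E := (P : PowerSeries E)
  have hV : PowerSeries.constantCoeff V ≠ 0 := by
    change PowerSeries.constantCoeff (P : PowerSeries E) ≠ 0
    rwa [← PowerSeries.coeff_zero_eq_constantCoeff_apply, Polynomial.coeff_coe, hP0]
  have hPV : HahnSeries.ofPowerSeries ℤ E V = laurentExpansion ξ (algebraMap _ _ s) := by
    rw [laurentExpansion_algebraMap]
    rfl
  have hexp : laurentExpansion ξ a = HahnSeries.ofPowerSeries ℤ E
      (V⁻¹ * ((taylor γ (c.map (algebraMap F E)) : E[X]) : PowerSeries E)) := by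
    have hc : HahnSeries.ofPowerSeries ℤ E ((taylor γ (c.map (algebraMap F E)) : E[X]) :
        PowerSeries E) = laurentExpansion ξ (algebraMap _ _ c) := by
      rw [laurentExpansion_algebraMap]
      rfl
    rw [map_mul, hc, ← h, laurentExpansion_mul, ← hPV, ← mul_assoc, ← map_mul, mul_comm V⁻¹,
      PowerSeries.mul_inv_cancel V hV, map_one, one_mul]
  have hres : residue ξ a = 0 := by
    rw [residue, hexp]
    exact (PowerSeries.coeff_coe _ _).trans (if_pos (by norm_num))
  rw [canonicalChar, hres, traceChar_zero]

theorem exists_reduction (j : ℕ) {a : RatFunc F} (ha : a ∈ localSubring hirr) :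
    ∃ c : F[X], ∃ t ∈ localSubring hirr,
      a = algebraMap F[X] (RatFunc F) c + algebraMap F[X] (RatFunc F) (π ^ j) * t := by
  obtain ⟨s, c, hs, h⟩ := ha
  obtain ⟨u, v, huv⟩ := (hirr.coprime_iff_not_dvd.2 hs).pow_left (m := j)
  have hs0 := algebraMap_ne_zero_of_not_dvd hs
  -- From `uπʲ + vs = 1` one has `c/s = vc + πʲ(uc/s)`.
  refine ⟨v * c, algebraMap _ _ (u * c) * (algebraMap _ _ s)⁻¹,
    mul_mem (algebraMap_mem_localSubring hirr _) (inv_mem_localSubring hirr hs), ?_⟩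
  apply mul_left_cancel₀ hs0
  rw [h]
  have := congrArg (algebraMap F[X] (RatFunc F)) huv
  simp only [map_add, map_mul, map_one] at this ⊢
  field_simp
  linear_combination (-algebraMap F[X] (RatFunc F) c) * this

theorem mk_eq_of_reduction (j : ℕ) {c c' : F[X]} {t : RatFunc F} (ht : t ∈ localSubring hirr)
    (h : algebraMap F[X] (RatFunc F) c - algebraMap F[X] (RatFunc F) c' =
      algebraMap F[X] (RatFunc F) (π ^ j) * t) :
    Ideal.Quotient.mk (Ideal.span {π ^ j}) c = Ideal.Quotient.mk _ c' := by
  obtain ⟨s, d, hs, hd⟩ := ht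
  rw [Ideal.Quotient.eq, Ideal.mem_span_singleton]
  refine ((hirr.coprime_iff_not_dvd.2 hs).pow_left (m := j)).dvd_of_dvd_mul_left ⟨d, ?_⟩
  apply IsFractionRing.injective F[X] (RatFunc F)
  rw [map_mul, map_sub, h, map_mul, ← hd]
  ring

/-- Reduction of the local ring modulo `πʲ`. -/
noncomputable def reduction (j : ℕ) : localSubring hirr →+ F[X] ⧸ Ideal.span {π ^ j} where
  toFun a := Ideal.Quotient.mk _ (exists_reduction hirr j a.2).choose
  map_zero' := by
    obtain ⟨t, ht, h⟩ := (exists_reduction hirr j (0 : localSubring hirr).2).choose_spec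
    rw [← map_zero (Ideal.Quotient.mk _)]
    refine mk_eq_of_reduction hirr j (neg_mem ht) ?_
    have h0 : ((0 : localSubring hirr) : RatFunc F) = 0 := rfl
    rw [map_zero]
    linear_combination h0 - h
  map_add' a b := by
    obtain ⟨t, ht, h⟩ := (exists_reduction hirr j (a + b).2).choose_spec
    obtain ⟨t₁, ht₁, h₁⟩ := (exists_reduction hirr j a.2).choose_spec
    obtain ⟨t₂, ht₂, h₂⟩ := (exists_reduction hirr j b.2).choose_spec
    rw [← map_add]
    refine mk_eq_of_reduction hirr j (sub_mem (add_mem ht₁ ht₂) ht) ?_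
    have h0 : ((a + b : localSubring hirr) : RatFunc F) = a + b := rfl
    rw [map_add]
    linear_combination h0 - h + h₁ + h₂

theorem reduction_algebraMap (j : ℕ) (c : F[X]) :
    reduction hirr j ⟨_, algebraMap_mem_localSubring hirr c⟩ = Ideal.Quotient.mk _ c := by
  obtain ⟨t, ht, h⟩ := (exists_reduction hirr j (algebraMap_mem_localSubring hirr c)).choose_spec
  refine mk_eq_of_reduction hirr j (neg_mem ht) ?_
  linear_combination -h

theorem levelChar_reduction [Finite F] {ξ : AlgebraicClosure F} (hξ : aeval ξ π = 0) (j : ℕ)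
    (f : F[X]) (a : localSubring hirr) :
    levelChar ξ (pow_ne_zero j hirr.ne_zero) (Ideal.Quotient.mk _ f * reduction hirr j a ^ 2) =
      canonicalChar ξ (algebraMap F[X] (RatFunc F) f * (a : RatFunc F) ^ 2 /
        algebraMap F[X] (RatFunc F) (π ^ j)) := by
  obtain ⟨t, ht, h⟩ := (exists_reduction hirr j a.2).choose_spec
  set c := (exists_reduction hirr j a.2).choose
  have hc : reduction hirr j a = Ideal.Quotient.mk _ c := rfl
  have hπ0 : algebraMap F[X] (RatFunc F) (π ^ j) ≠ 0 := by
    simpa using fun h => absurd h hirr.ne_zero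
  rw [hc, ← map_pow, ← map_mul, levelChar_mk]
  -- Squaring `a = c + πʲt` leaves the error `f·t(2c + πʲt)` after division by `πʲ`; it is integral
  -- at `π`, so the character ignores it.
  have : algebraMap F[X] (RatFunc F) f * (a : RatFunc F) ^ 2 /
        algebraMap F[X] (RatFunc F) (π ^ j) =
      algebraMap F[X] (RatFunc F) (f * c ^ 2) / algebraMap F[X] (RatFunc F) (π ^ j) +
      algebraMap F[X] (RatFunc F) f * (t * (algebraMap F[X] (RatFunc F) (2 * c) +
        algebraMap F[X] (RatFunc F) (π ^ j) * t)) := by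
    rw [h]
    simp only [map_mul, map_pow, map_ofNat] at hπ0 ⊢
    field_simp
    ring
  rw [this, canonicalChar_add, canonicalChar_eq_one_of_mem hirr hξ (a := _ * _), mul_one]
  have hm := algebraMap_mem_localSubring hirr (F := F)
  exact mul_mem (hm _) (mul_mem ht (add_mem (hm _) (mul_mem (hm _) ht)))

include hirr in
/-- Up to squares of units, elements of `F(t)` are `πᵉ f` with `f` a polynomial prime to `π`. -/
theorem exists_mul_sq_eq {a : RatFunc F} (ha : a ≠ 0) : ∃ (g : F[X]) (e : ℤ) (f : F[X]),
    ¬ π ∣ g ∧ ¬ π ∣ f ∧ a * algebraMap F[X] (RatFunc F) g ^ 2 =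
      algebraMap F[X] (RatFunc F) π ^ e * algebraMap F[X] (RatFunc F) f := by
  have hfin : ∀ {b : F[X]}, b ≠ 0 → ∃ (i : ℕ) (c : F[X]), ¬ π ∣ c ∧ b = π ^ i * c := by
    intro b hb
    obtain ⟨i, c, hc, h⟩ := WfDvdMonoid.max_power_factor hb hirr
    exact ⟨i, c, hc, h⟩
  obtain ⟨i, n, hn, hin⟩ := hfin (RatFunc.num_ne_zero ha)
  obtain ⟨j, d, hd, hjd⟩ := hfin (RatFunc.denom_ne_zero a)
  have hπ0 : algebraMap F[X] (RatFunc F) π ≠ 0 := by simpa using hirr.ne_zero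
  have hd0 := algebraMap_ne_zero_of_not_dvd hd
  refine ⟨d, i - j, n * d, hd, fun h => (hirr.prime.dvd_or_dvd h).elim hn hd, ?_⟩
  have h := RatFunc.num_div_denom a
  rw [hin, hjd] at h
  rw [← h, zpow_sub₀ hπ0]
  simp only [map_mul, map_pow, zpow_natCast]
  field_simp

end LocalRing

/-! ### Existence of Jordan splittings -/

section Jordan

variable {F : Type*} [Field F] {π : F[X]} {W : Type*} [AddCommGroup W] [Module F[X] W]
  [Module (RatFunc F) W]

/-- An orthogonal family in `L` generating `L` locally at `π`, with `Q(vᵢ) = πᵉⁱ fᵢ`; within a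
block of constant `e`, only the last `fᵢ` may be a nonsquare modulo `π`. -/
structure JordanSplitting (hirr : Irreducible π) (Q : QuadraticForm (RatFunc F) W)
    (L : Submodule F[X] W) (n : ℕ) where
  /-- the vectors -/
  v : Fin n → W
  /-- the exponents -/
  e : Fin n → ℤ
  /-- the unit parts -/
  f : Fin n → F[X]
  mem : ∀ i, v i ∈ L
  not_dvd : ∀ i, ¬ π ∣ f i
  apply_eq : ∀ i, Q (v i) = algebraMap F[X] (RatFunc F) π ^ e i * algebraMap F[X] (RatFunc F) (f i)
  ortho : ∀ i j, i < j → QuadraticMap.polar Q (v i) (v j) = 0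
  sorted : ∀ i j, i < j → e i < e j ∨ (e i = e j ∧ IsSquareMod π (f i))
  generates : ∀ y ∈ L, ∃ c : Fin n → RatFunc F, (∀ i, c i ∈ localSubring hirr) ∧
    y = ∑ i, c i • v i

variable [IsScalarTower F[X] (RatFunc F) W]

/-- The values of a quadratic form on a finitely generated module have a common denominator. -/
theorem exists_common_denominator [Invertible (2 : RatFunc F)] (Q : QuadraticForm (RatFunc F) W)
    (L : Submodule F[X] W) (hL : L.FG) : ∃ d : F[X], d ≠ 0 ∧ ∀ x ∈ L, ∃ h : F[X],
      algebraMap F[X] (RatFunc F) d * Q x = algebraMap F[X] (RatFunc F) h := by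
  let B : W →ₗ[F[X]] W →ₗ[F[X]] RatFunc F :=
    Q.polarBilin.restrictScalars₁₂ F[X] F[X]
  obtain ⟨d, hd, hdM⟩ := FractionalIdeal.isFractional_of_fg (S := nonZeroDivisors F[X])
    (Submodule.FG.map₂ B hL hL)
  have h2 : (2 : RatFunc F) ≠ 0 := Invertible.ne_zero _
  have h2' : (2 : F[X]) ≠ 0 := by
    intro h
    apply h2
    rw [← map_ofNat (algebraMap F[X] (RatFunc F)) 2, h, map_zero]
  refine ⟨d * 2, mul_ne_zero (nonZeroDivisors.ne_zero hd) h2', fun x hx => ?_⟩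
  obtain ⟨h, hh⟩ := hdM _ (Submodule.apply_mem_map₂ B hx hx)
  refine ⟨h, ?_⟩
  have hB : B x x = QuadraticMap.polar Q x x := rfl
  rw [hh, hB, QuadraticMap.polar_self, Algebra.smul_def, map_mul, map_ofNat, nsmul_eq_mul,
    Nat.cast_ofNat, mul_assoc]

variable (hirr : Irreducible π)

theorem algebraMap_smul_eq (g : F[X]) (x : W) : g • x = algebraMap F[X] (RatFunc F) g • x :=
  (algebraMap_smul (RatFunc F) g x).symm

theorem map_smul_eq (Q : QuadraticForm (RatFunc F) W) (g : F[X]) (x : W) :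
    Q (g • x) = algebraMap F[X] (RatFunc F) g ^ 2 * Q x := by
  rw [algebraMap_smul_eq, QuadraticMap.map_smul, smul_eq_mul, sq]

include hirr in
/-- A vector of minimal order, with unit part a square modulo `π` if possible. -/
theorem exists_minimal_vector [Invertible (2 : RatFunc F)] (Q : QuadraticForm (RatFunc F) W)
    (hQ : Q.Anisotropic) (L : Submodule F[X] W) (hL : L.FG) (hL0 : L ≠ ⊥) :
    ∃ x ∈ L, ∃ (e : ℤ) (f : F[X]), ¬ π ∣ f ∧
      Q x = algebraMap F[X] (RatFunc F) π ^ e * algebraMap F[X] (RatFunc F) f ∧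
      ∀ y ∈ L, ∀ (e' : ℤ) (f' : F[X]), ¬ π ∣ f' →
        Q y = algebraMap F[X] (RatFunc F) π ^ e' * algebraMap F[X] (RatFunc F) f' →
        e < e' ∨ (e = e' ∧ (IsSquareMod π f' → IsSquareMod π f)) := by
  have hπ0 : algebraMap F[X] (RatFunc F) π ≠ 0 := by simpa using hirr.ne_zero
  let T : Set ℤ := {e | ∃ x ∈ L, ∃ f : F[X], ¬ π ∣ f ∧
    Q x = algebraMap F[X] (RatFunc F) π ^ e * algebraMap F[X] (RatFunc F) f}
  have hT : T.Nonempty := by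
    obtain ⟨x, hx, hx0⟩ := L.exists_mem_ne_zero_of_ne_bot hL0
    obtain ⟨g, e, f, -, hf, h⟩ := exists_mul_sq_eq hirr (mt (hQ x) hx0)
    exact ⟨e, g • x, L.smul_mem g hx, f, hf, by rw [map_smul_eq, ← h, mul_comm]⟩
  obtain ⟨d, hd, hden⟩ := exists_common_denominator Q L hL
  -- If `Q(x)` has order `-m < 0`, then `πᵐ` divides the common denominator `d`, whence `m ≤ deg d`.
  have hbdd : ∀ e ∈ T, -(d.natDegree : ℤ) ≤ e := by
    rintro e ⟨x, hx, f, hf, h⟩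
    by_contra! hlt
    obtain ⟨b, hb⟩ := hden x hx
    obtain ⟨m, hm⟩ : ∃ m : ℕ, e = -(m : ℤ) := ⟨e.natAbs, by omega⟩
    rw [h, hm, zpow_neg, zpow_natCast, mul_left_comm,
      inv_mul_eq_iff_eq_mul₀ (pow_ne_zero _ hπ0), ← map_pow, ← map_mul, ← map_mul] at hb
    have hb := IsFractionRing.injective F[X] (RatFunc F) hb
    have hdvd : π ^ m ∣ d :=
      ((hirr.coprime_iff_not_dvd.2 hf).pow_left (m := m)).dvd_of_dvd_mul_right ⟨b, hb⟩
    have hdeg := natDegree_le_of_dvd hdvd hd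
    have hπd : 0 < π.natDegree := hirr.natDegree_pos
    rw [natDegree_pow] at hdeg
    have : m ≤ m * π.natDegree := Nat.le_mul_of_pos_right m hπd
    omega
  obtain ⟨e, ⟨x, hx, f, hf, h⟩, hmin⟩ := Int.exists_least_of_bdd ⟨_, hbdd⟩ hT
  by_cases hsq : ∃ x ∈ L, ∃ f : F[X], ¬ π ∣ f ∧
    Q x = algebraMap F[X] (RatFunc F) π ^ e * algebraMap F[X] (RatFunc F) f ∧ IsSquareMod π f
  · obtain ⟨x, hx, f, hf, h, hs⟩ := hsq
    refine ⟨x, hx, e, f, hf, h, fun y hy e' f' hf' h' => ?_⟩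
    exact (hmin e' ⟨y, hy, f', hf', h'⟩).lt_or_eq.imp_right fun h => ⟨h, fun _ => hs⟩
  · refine ⟨x, hx, e, f, hf, h, fun y hy e' f' hf' h' => ?_⟩
    refine (hmin e' ⟨y, hy, f', hf', h'⟩).lt_or_eq.imp_right fun he => ⟨he, fun hs => ?_⟩
    exact absurd ⟨y, hy, f', hf', he ▸ h', hs⟩ hsq

/-- Induction on the rank, splitting off a vector `x` of minimal order `e`. Since `πᵉ` divides `Q(x
+ y)`, `Q(x)` and `Q(y)` locally, and `2Q(x)/πᵉ` is a local unit, orthogonal projection onto `x` has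
locally integral coefficients. Hence `x` and `L ∩ x^⊥` generate `L` locally. -/
theorem nonempty_jordanSplitting [Finite F] [Invertible (2 : RatFunc F)]
    (Q : QuadraticForm (RatFunc F) W) (hQ : Q.Anisotropic) (L : Submodule F[X] W) (hL : L.FG) :
    ∃ n, Nonempty (JordanSplitting hirr Q L n) := by
  have hπ0 : algebraMap F[X] (RatFunc F) π ≠ 0 := by simpa using hirr.ne_zero
  have h2 : (2 : RatFunc F) ≠ 0 := Invertible.ne_zero _
  have hfd : ∀ M : Submodule F[X] W, M.FG →
      FiniteDimensional (RatFunc F) (Submodule.span (RatFunc F) (M : Set W)) := by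
    rintro M ⟨S, rfl⟩
    rw [Submodule.span_span_of_tower]
    exact FiniteDimensional.span_finset _ S
  induction hr : Module.finrank (RatFunc F) (Submodule.span (RatFunc F) (L : Set W))
    using Nat.strong_induction_on generalizing L with
  | _ r ih =>
  by_cases hL0 : L = ⊥
  · refine ⟨0, ⟨⟨Fin.elim0, Fin.elim0, Fin.elim0, fun i => i.elim0, fun i => i.elim0,
      fun i => i.elim0, fun i => i.elim0, fun i => i.elim0, fun y hy => ⟨Fin.elim0,
      fun i => i.elim0, ?_⟩⟩⟩⟩
    rw [hL0, Submodule.mem_bot] at hy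
    simp [hy]
  obtain ⟨x, hx, e, f, hf, hQx, hmin⟩ := exists_minimal_vector hirr Q hQ L hL hL0
  have hf0 := algebraMap_ne_zero_of_not_dvd hf
  have hQx0 : Q x ≠ 0 := by
    rw [hQx]
    exact mul_ne_zero (zpow_ne_zero _ hπ0) hf0
  let L₁ : Submodule F[X] W := L ⊓ (LinearMap.ker (Q.polarBilin x)).restrictScalars F[X]
  have hL₁ : ∀ y, y ∈ L₁ ↔ y ∈ L ∧ QuadraticMap.polar Q x y = 0 := fun y => Iff.rfl
  have hL₁fg : L₁.FG := by
    have := isNoetherian_of_fg_of_noetherian L hL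
    exact Submodule.FG.of_le hL inf_le_left
  have hlt : Module.finrank (RatFunc F) (Submodule.span (RatFunc F) (L₁ : Set W)) < r := by
    have := hfd L hL
    rw [← hr]
    refine Submodule.finrank_lt_finrank_of_lt (lt_of_le_of_ne
      (Submodule.span_mono fun y hy => hy.1) fun heq => ?_)
    have h1 : x ∈ Submodule.span (RatFunc F) (L₁ : Set W) := by
      rw [heq]
      exact Submodule.subset_span hx
    have h3 : Submodule.span (RatFunc F) (L₁ : Set W) ≤ LinearMap.ker (Q.polarBilin x) :=
      Submodule.span_le.2 fun y hy => hy.2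
    have h4 : QuadraticMap.polar Q x x = 0 := h3 h1
    rw [QuadraticMap.polar_self, nsmul_eq_mul, Nat.cast_ofNat] at h4
    exact mul_ne_zero h2 hQx0 h4
  obtain ⟨n, ⟨J⟩⟩ := ih _ hlt L₁ hL₁fg rfl
  have hint : ∀ y ∈ L, ∃ a ∈ localSubring hirr,
      Q y = algebraMap F[X] (RatFunc F) π ^ e * a := by
    intro y hy
    by_cases hy0 : Q y = 0
    · exact ⟨0, zero_mem _, by rw [hy0, mul_zero]⟩
    obtain ⟨g, e', f', hg, hf', h⟩ := exists_mul_sq_eq hirr hy0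
    have hle := hmin (g • y) (L.smul_mem g hy) e' f' hf' (by rw [map_smul_eq, ← h, mul_comm])
    obtain ⟨m, hm⟩ : ∃ m : ℕ, e' = e + m := ⟨(e' - e).toNat, by omega⟩
    have hg0 := algebraMap_ne_zero_of_not_dvd hg
    refine ⟨algebraMap _ _ (π ^ m * f') * (algebraMap _ _ g)⁻¹ ^ 2,
      mul_mem (algebraMap_mem_localSubring hirr _) (pow_mem (inv_mem_localSubring hirr hg) 2), ?_⟩
    rw [hm, zpow_add₀ hπ0, zpow_natCast] at h
    rw [eq_div_of_mul_eq (pow_ne_zero 2 hg0) h, map_mul, map_pow]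
    field_simp
  have hcoef : ∀ y ∈ L, QuadraticMap.polar Q x y / (2 * Q x) ∈ localSubring hirr := by
    intro y hy
    obtain ⟨a, ha, h⟩ := hint _ (L.add_mem hx hy)
    obtain ⟨b, hb, h'⟩ := hint _ hy
    have h2f : ¬ π ∣ 2 * f := by
      intro h
      have h2u : IsUnit (2 : F[X]) := by
        have := (IsUnit.mk0 _ (two_ne_zero_of_invertible (F := F))).map (C : F →+* F[X])
        rwa [map_ofNat] at this
      exact (hirr.prime.dvd_or_dvd h).elim (fun h => hirr.not_isUnit (isUnit_of_dvd_unit h h2u)) hf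
    have : QuadraticMap.polar Q x y / (2 * Q x) =
        (a - algebraMap F[X] (RatFunc F) f - b) * (algebraMap F[X] (RatFunc F) (2 * f))⁻¹ := by
      rw [QuadraticMap.polar, h, h', hQx, map_mul, map_ofNat]
      have := zpow_ne_zero e hπ0
      field_simp
    rw [this]
    exact mul_mem (sub_mem (sub_mem ha (algebraMap_mem_localSubring hirr f)) hb) (inv_mem_localSubring hirr h2f)
  refine ⟨n + 1, ⟨⟨Fin.cons x J.v, Fin.cons e J.e, Fin.cons f J.f, ?_, ?_, ?_, ?_, ?_, ?_⟩⟩⟩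
  · exact Fin.cases hx fun i => (J.mem i).1
  · exact Fin.cases hf J.not_dvd
  · exact Fin.cases hQx J.apply_eq
  · refine Fin.cases (Fin.cases (fun h => absurd h (lt_irrefl _)) fun j _ => (J.mem j).2)
      fun i => Fin.cases (fun h => absurd h (Fin.not_lt_zero _)) fun j hij =>
        J.ortho i j (Fin.succ_lt_succ_iff.1 hij)
  · refine Fin.cases (Fin.cases (fun h => absurd h (lt_irrefl _)) fun j _ => ?_)
      fun i => Fin.cases (fun h => absurd h (Fin.not_lt_zero _)) fun j hij =>
        J.sorted i j (Fin.succ_lt_succ_iff.1 hij)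
    simp only [Fin.cons_zero, Fin.cons_succ]
    refine (hmin (J.v j) (J.mem j).1 (J.e j) (J.f j) (J.not_dvd j) (J.apply_eq j)).imp_right ?_
    rintro ⟨he, -⟩
    refine ⟨he, ?_⟩
    -- If a later vector also has order `e`, some combination with `x` has order `e` and unit part
    -- congruent to `1`. The choice of `x` then forces its own unit part to be a square.
    obtain ⟨a, b, hab⟩ := exists_isSquareMod_of_sum hirr two_ne_zero_of_invertible hf (J.not_dvd j)
    have hz : Q (a • x + b • J.v j) = algebraMap F[X] (RatFunc F) π ^ e *
        algebraMap F[X] (RatFunc F) (f * a ^ 2 + J.f j * b ^ 2) := by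
      have hp : QuadraticMap.polar Q (a • x) (b • J.v j) = 0 := by
        rw [algebraMap_smul_eq, algebraMap_smul_eq, QuadraticMap.polar_smul_left,
          QuadraticMap.polar_smul_right, ((hL₁ _).1 (J.mem j)).2, smul_zero, smul_zero]
      rw [QuadraticMap.map_add Q, hp, map_smul_eq, map_smul_eq, hQx, J.apply_eq, ← he]
      simp only [map_add, map_mul, map_pow]
      ring
    have hnd : ¬ π ∣ f * a ^ 2 + J.f j * b ^ 2 := by
      intro h
      have := dvd_sub h hab
      rw [sub_sub_cancel] at this
      exact hirr.not_isUnit (isUnit_of_dvd_one this)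
    rcases hmin _ (L.add_mem (L.smul_mem a hx) (L.smul_mem b (J.mem j).1)) e _ hnd hz with h | h
    · exact absurd h (lt_irrefl _)
    · exact h.2 ⟨1, by rwa [one_pow]⟩
  · intro y hy
    -- The projection of `y` need not lie in `L`; multiplying by the denominator `s` of its
    -- coefficient, a local unit, brings it there.
    obtain ⟨s, c, hs, hsc⟩ := hcoef y hy
    have hs0 := algebraMap_ne_zero_of_not_dvd hs
    have hmem : s • y - c • x ∈ L₁ := by
      rw [hL₁]
      refine ⟨L.sub_mem (L.smul_mem _ hy) (L.smul_mem _ hx), ?_⟩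
      rw [algebraMap_smul_eq, algebraMap_smul_eq, QuadraticMap.polar_sub_right,
        QuadraticMap.polar_smul_right, QuadraticMap.polar_smul_right, QuadraticMap.polar_self,
        ← hsc]
      simp only [smul_eq_mul, nsmul_eq_mul, Nat.cast_ofNat]
      field_simp
      ring
    obtain ⟨t, ht, hyt⟩ := J.generates _ hmem
    refine ⟨Fin.cons (QuadraticMap.polar Q x y / (2 * Q x))
      fun i => (algebraMap F[X] (RatFunc F) s)⁻¹ * t i, ?_, ?_⟩
    · exact Fin.cases (hcoef y hy) fun i => mul_mem (inv_mem_localSubring hirr hs) (ht i)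
    · rw [Fin.sum_univ_succ]
      simp only [Fin.cons_zero, Fin.cons_succ, mul_smul]
      rw [← Finset.smul_sum, ← hyt, smul_sub, algebraMap_smul_eq, inv_smul_smul₀ hs0,
        algebraMap_smul_eq c, ← hsc, mul_smul, inv_smul_smul₀ hs0]
      abel

end Jordan

theorem map_sum_of_pairwise_polar_eq_zero {k V ι : Type*} [Field k] [AddCommGroup V] [Module k V]
    (Q : QuadraticForm k V) (s : Finset ι) (w : ι → V)
    (h : ∀ i ∈ s, ∀ j ∈ s, i ≠ j → QuadraticMap.polar Q (w i) (w j) = 0) :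
    Q (∑ i ∈ s, w i) = ∑ i ∈ s, Q (w i) := by
  classical
  induction s using Finset.induction_on with
  | empty => simp
  | insert a s ha ih =>
    rw [Finset.sum_insert ha, Finset.sum_insert ha, QuadraticMap.map_add Q, ih fun i hi j hj =>
      h i (Finset.mem_insert_of_mem hi) j (Finset.mem_insert_of_mem hj)]
    have : QuadraticMap.polar Q (w a) (∑ i ∈ s, w i) = 0 := by
      rw [← QuadraticMap.polarBilin_apply_apply, map_sum]
      refine Finset.sum_eq_zero fun i hi => h a (Finset.mem_insert_self _ _) i
        (Finset.mem_insert_of_mem hi) ?_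
      rintro rfl
      exact ha hi
    rw [this, add_zero]

/-- All fibres of a surjective homomorphism have the same size, so averages may be computed on the
image. -/
theorem sum_comp_surjective_div_card {G H : Type*} [AddGroup G] [AddGroup H] [Fintype G] [Fintype H]
    (φ : G →+ H) (hφ : Function.Surjective φ) (Φ : H → ℂ) :
    (Fintype.card G : ℂ)⁻¹ * ∑ g, Φ (φ g) = (Fintype.card H : ℂ)⁻¹ * ∑ h, Φ h := by
  classical
  obtain ⟨c, hc⟩ : ∃ c : ℕ, ∀ h : H, (Finset.univ.filter fun g => φ g = h).card = c :=
    ⟨_, fun h => AddMonoidHom.card_fiber_eq_of_mem_range φ (hφ h) (hφ 0)⟩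
  have h1 : ∑ g, Φ (φ g) = (c : ℂ) * ∑ h, Φ h := by
    rw [← Finset.sum_fiberwise Finset.univ φ, Finset.mul_sum]
    refine Finset.sum_congr rfl fun h _ => ?_
    rw [Finset.sum_congr rfl fun g hg => by rw [(Finset.mem_filter.1 hg).2], Finset.sum_const, hc,
      nsmul_eq_mul]
  have h2 : Fintype.card G = c * Fintype.card H := by
    rw [← Finset.card_univ, Finset.card_eq_sum_card_fiberwise (f := φ) (t := Finset.univ)
      (fun _ _ => Finset.mem_coe.2 (Finset.mem_univ _)),
      Finset.sum_congr rfl fun h _ => hc h, Finset.sum_const, smul_eq_mul, mul_comm]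
    rfl
  have h3 : (c : ℂ) ≠ 0 := by
    have : Fintype.card G ≠ 0 := Fintype.card_ne_zero
    rw [h2] at this
    exact_mod_cast left_ne_zero_of_mul this
  rw [h1, h2]
  push_cast
  rw [mul_inv, mul_assoc, mul_left_comm _ (c : ℂ), ← mul_assoc, inv_mul_cancel₀ h3, one_mul]

theorem algebraMap_ne_zero_of_irreducible {F : Type*} [Field F] {π : F[X]} (hirr : Irreducible π) :
    algebraMap F[X] (RatFunc F) π ≠ 0 := by simpa using hirr.ne_zero

/-! ### The averages as products of Gauss sums -/

section Average

variable {F : Type*} [Field F] {π : F[X]} {W : Type*} [AddCommGroup W] [Module F[X] W]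
  [Module (RatFunc F) W] {hirr : Irreducible π}
  {Q : QuadraticForm (RatFunc F) W} {L : Submodule F[X] W} {n : ℕ}

namespace JordanSplitting

variable (J : JordanSplitting hirr Q L n)

theorem apply_ne_zero (i : Fin n) : Q (J.v i) ≠ 0 := by
  rw [J.apply_eq]
  exact mul_ne_zero (zpow_ne_zero _ (algebraMap_ne_zero_of_irreducible hirr))
    (algebraMap_ne_zero_of_not_dvd (J.not_dvd i))

theorem polar_eq_zero {i j : Fin n} (hij : i ≠ j) : QuadraticMap.polar Q (J.v i) (J.v j) = 0 := by
  rcases hij.lt_or_gt with h | h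
  · exact J.ortho i j h
  · rw [QuadraticMap.polar_comm]
    exact J.ortho j i h

theorem map_sum_smul (c : Fin n → RatFunc F) : Q (∑ i, c i • J.v i) = ∑ i, c i ^ 2 * Q (J.v i) := by
  rw [map_sum_of_pairwise_polar_eq_zero]
  · exact Finset.sum_congr rfl fun i _ => by rw [QuadraticMap.map_smul, smul_eq_mul, sq]
  · intro i _ j _ hij
    rw [QuadraticMap.polar_smul_left, QuadraticMap.polar_smul_right, J.polar_eq_zero hij, smul_zero,
      smul_zero]

/-- The coordinates with respect to the orthogonal family. -/
noncomputable def coord (i : Fin n) : W →ₗ[RatFunc F] RatFunc F :=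
  (2 * Q (J.v i))⁻¹ • Q.polarBilin (J.v i)

variable [Invertible (2 : RatFunc F)]

theorem coord_sum_smul (c : Fin n → RatFunc F) (i : Fin n) :
    J.coord i (∑ j, c j • J.v j) = c i := by
  rw [coord, LinearMap.smul_apply, map_sum, Finset.sum_eq_single i, map_smul,
    QuadraticMap.polarBilin_apply_apply, QuadraticMap.polar_self, nsmul_eq_mul, Nat.cast_ofNat,
    smul_eq_mul, smul_eq_mul, mul_left_comm, inv_mul_cancel₀, mul_one]
  · exact mul_ne_zero (Invertible.ne_zero _) (J.apply_ne_zero i)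
  · intro j _ hj
    rw [map_smul, QuadraticMap.polarBilin_apply_apply, J.polar_eq_zero hj.symm, smul_zero]
  · exact fun h => absurd (Finset.mem_univ i) h

theorem coord_mem {y : W} (hy : y ∈ L) (i : Fin n) : J.coord i y ∈ localSubring hirr := by
  obtain ⟨c, hc, rfl⟩ := J.generates y hy
  rw [coord_sum_smul]
  exact hc i

theorem apply_eq_sum {y : W} (hy : y ∈ L) : Q y = ∑ i, J.coord i y ^ 2 * Q (J.v i) := by
  obtain ⟨c, hc, rfl⟩ := J.generates y hy
  simp only [coord_sum_smul, map_sum_smul]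

/-- The coordinates of lattice vectors, modulo given powers of `π`. -/
noncomputable def reducedCoord (j : Fin n → ℕ) :
    L →+ ((i : Fin n) → F[X] ⧸ Ideal.span {π ^ j i}) where
  toFun y i := reduction hirr (j i) ⟨J.coord i y, J.coord_mem y.2 i⟩
  map_zero' := by
    funext i
    rw [Pi.zero_apply, ← map_zero (reduction hirr (j i))]
    exact congrArg _ (Subtype.ext (map_zero (J.coord i)))
  map_add' x y := by
    funext i
    rw [Pi.add_apply, ← map_add (reduction hirr (j i))]
    exact congrArg _ (Subtype.ext (map_add (J.coord i) _ _))

/-- The `vᵢ` lie in `L` itself, so their polynomial combinations realize every tuple of residues. -/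
theorem reducedCoord_surjective [IsScalarTower F[X] (RatFunc F) W] (j : Fin n → ℕ) :
    Function.Surjective (J.reducedCoord j) := by
  intro r
  choose a ha using fun i => Ideal.Quotient.mk_surjective (r i)
  refine ⟨⟨∑ i, a i • J.v i, L.sum_mem fun i _ => L.smul_mem _ (J.mem i)⟩, ?_⟩
  funext i
  rw [← ha, ← reduction_algebraMap hirr]
  refine congrArg (reduction hirr (j i)) (Subtype.ext ?_)
  change J.coord i (∑ i, a i • J.v i) = _
  simp only [algebraMap_smul_eq (W := W)]
  exact J.coord_sum_smul _ i

end JordanSplitting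

theorem canonicalChar_sum [Finite F] (ξ : AlgebraicClosure F) {ι : Type*} (s : Finset ι)
    (g : ι → RatFunc F) : canonicalChar ξ (∑ i ∈ s, g i) = ∏ i ∈ s, canonicalChar ξ (g i) := by
  classical
  induction s using Finset.induction_on with
  | empty =>
    rw [Finset.sum_empty, Finset.prod_empty, ← map_zero (algebraMap F[X] (RatFunc F)),
      canonicalChar_algebraMap]
  | insert a s ha ih => rw [Finset.sum_insert ha, Finset.prod_insert ha, canonicalChar_add, ih]

variable [Finite F] {ξ : AlgebraicClosure F} (J : JordanSplitting hirr Q L n)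
  [Invertible (2 : RatFunc F)]

theorem canonicalChar_scaledForm (hξ : aeval ξ π = 0) (k : ℤ) (y : L) :
    canonicalChar ξ (scaledForm π k Q y) = ∏ i,
      levelChar ξ (pow_ne_zero (k - J.e i).toNat hirr.ne_zero)
        (Ideal.Quotient.mk _ (J.f i) * J.reducedCoord (fun i => (k - J.e i).toNat) y i ^ 2) := by
  have hπ0 := (algebraMap_ne_zero_of_irreducible hirr)
  have h1 : scaledForm π k Q y = algebraMap F[X] (RatFunc F) π ^ (-k) * Q y := rfl
  rw [h1, J.apply_eq_sum y.2, Finset.mul_sum, canonicalChar_sum]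
  refine Finset.prod_congr rfl fun i _ => ?_
  have h3 := levelChar_reduction hirr hξ (k - J.e i).toNat (J.f i)
    ⟨J.coord i y, J.coord_mem y.2 i⟩
  refine Eq.trans ?_ h3.symm
  rw [J.apply_eq]
  by_cases hk : J.e i ≤ k
  · obtain ⟨j, hj⟩ : ∃ j : ℕ, k = J.e i + j := ⟨(k - J.e i).toNat, by omega⟩
    have hj' : (k - J.e i).toNat = j := by omega
    rw [hj', hj, neg_add, zpow_add₀ hπ0, zpow_neg, zpow_neg, zpow_natCast, map_pow]
    congr 1
    have := zpow_ne_zero (J.e i) hπ0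
    field_simp
  -- For `k < eᵢ` the `i`-th term of `π⁻ᵏQ` is integral at `π`, so both sides are `1`.
  · have hj' : (k - J.e i).toNat = 0 := by omega
    obtain ⟨j, hj⟩ : ∃ j : ℕ, J.e i = k + j := ⟨(J.e i - k).toNat, by omega⟩
    have hm := algebraMap_mem_localSubring (F := F) hirr
    rw [canonicalChar_eq_one_of_mem hirr hξ, canonicalChar_eq_one_of_mem hirr hξ]
    · rw [hj', pow_zero, map_one, div_one]
      exact mul_mem (hm _) (pow_mem (J.coord_mem y.2 i) 2)
    · rw [hj, zpow_add₀ hπ0, zpow_neg, zpow_natCast]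
      have : (algebraMap F[X] (RatFunc F) π ^ k)⁻¹ * (J.coord i y ^ 2 *
          (algebraMap F[X] (RatFunc F) π ^ k * algebraMap F[X] (RatFunc F) π ^ j *
            algebraMap F[X] (RatFunc F) (J.f i))) =
          J.coord i y ^ 2 * (algebraMap F[X] (RatFunc F) (π ^ j * J.f i)) := by
        have := zpow_ne_zero k hπ0
        rw [map_mul, map_pow]
        field_simp
      rw [this]
      exact mul_mem (pow_mem (J.coord_mem y.2 i) 2) (hm _)

/-- The partial averages are eventually products of quadratic Gauss sums. -/
theorem eventually_partialAverage_eq [IsScalarTower F[X] (RatFunc F) W] (hξ : aeval ξ π = 0)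
    (hL : Submodule.IsLattice (RatFunc F) L) (hQ : IsDefinite Q) (k : ℤ) :
    ∀ᶠ m in atTop, partialAverage ξ L (scaledForm π k Q) m =
      ∏ i, levelMean ξ hirr.ne_zero (k - J.e i).toNat (J.f i) := by
  classical
  set j : Fin n → ℕ := fun i => (k - J.e i).toNat with hj
  have hfin : ∀ i, Finite (F[X] ⧸ Ideal.span {π ^ j i}) := fun i =>
    finite_quotient_span_singleton (pow_ne_zero _ hirr.ne_zero)
  have := fun i => Fintype.ofFinite (F[X] ⧸ Ideal.span {π ^ j i})
  let H := (i : Fin n) → F[X] ⧸ Ideal.span {π ^ j i}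
  -- There are finitely many residue tuples. Once the degree bound exceeds the degrees of `Q` on
  -- chosen lifts, `L_m` itself maps onto all of them.
  choose y hy using J.reducedCoord_surjective j
  have hM : ∀ r : H, ∃ M : ℤ, ∀ m ≥ M, (y r : W) ∈ filtration L Q m := fun r =>
    ⟨(Q (y r)).intDegree, fun m hm => ⟨(y r).2, Or.inr hm⟩⟩
  choose M hM using hM
  obtain ⟨M₀, hM₀⟩ := Finite.exists_le M
  filter_upwards [eventually_ge_atTop (M₀ - k * π.natDegree)] with m hm
  rw [partialAverage, filtration_scaledForm L Q hirr.ne_zero]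
  set m' := m + k * π.natDegree
  let G := filtrationSubgroup L Q hQ m'
  have : Finite G := (finite_filtration L hL Q hQ m').to_subtype
  have := Fintype.ofFinite G
  let φ : G →+ H := (J.reducedCoord j).comp
    ((AddSubgroup.inclusion (show G ≤ L.toAddSubgroup from fun x hx => hx.1)))
  have hφ : Function.Surjective φ := fun r =>
    ⟨⟨y r, hM r m' ((hM₀ r).trans (by omega))⟩, hy r⟩
  have key := sum_comp_surjective_div_card φ hφ fun r => ∏ i,
    levelChar ξ (pow_ne_zero (j i) hirr.ne_zero) (Ideal.Quotient.mk _ (J.f i) * r i ^ 2)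
  have h1 : (filtration L Q m').ncard = Fintype.card G := by
    rw [← Nat.card_eq_fintype_card]
    exact (Nat.card_coe_set_eq _).symm
  have h2 : ∑ᶠ x ∈ filtration L Q m', canonicalChar ξ (scaledForm π k Q x) =
      ∑ g : G, ∏ i, levelChar ξ (pow_ne_zero (j i) hirr.ne_zero)
        (Ideal.Quotient.mk _ (J.f i) * φ g i ^ 2) := by
    rw [← finsum_eq_sum_of_fintype, ← finsum_set_coe_eq_finsum_mem]
    exact finsum_congr fun g => canonicalChar_scaledForm J hξ k ⟨g, g.2.1⟩
  rw [h1, h2, key]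
  have h3 : ∑ r : H, ∏ i, levelChar ξ (pow_ne_zero (j i) hirr.ne_zero)
      (Ideal.Quotient.mk _ (J.f i) * r i ^ 2) = ∏ i, ∑ z : F[X] ⧸ Ideal.span {π ^ j i},
      levelChar ξ (pow_ne_zero (j i) hirr.ne_zero) (Ideal.Quotient.mk _ (J.f i) * z ^ 2) := by
    rw [Finset.prod_univ_sum, Fintype.piFinset_univ]
  rw [h3, Fintype.card_pi]
  push_cast
  rw [← Finset.prod_inv_distrib, ← Finset.prod_mul_distrib]
  refine Finset.prod_congr rfl fun i _ => ?_
  rw [levelMean, quadMean, finsum_eq_sum_of_fintype, Nat.card_eq_fintype_card]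

theorem average_eq [IsScalarTower F[X] (RatFunc F) W] (hξ : aeval ξ π = 0)
    (hL : Submodule.IsLattice (RatFunc F) L) (hQ : IsDefinite Q) (k : ℤ) :
    average ξ L (scaledForm π k Q) =
      ∏ i, levelMean ξ hirr.ne_zero (k - J.e i).toNat (J.f i) :=
  (tendsto_nhds_of_eventually_eq (eventually_partialAverage_eq J hξ hL hQ k)).limUnder_eq

/-- The representation numbers determine the averages. -/
theorem average_eq_of_repNumber_eq {W' : Type*} [AddCommGroup W'] [Module F[X] W']
    [Module (RatFunc F) W'] [IsScalarTower F[X] (RatFunc F) W] [IsScalarTower F[X] (RatFunc F) W']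
    (ξ : AlgebraicClosure F) {π : F[X]} (hπ : π ≠ 0)
    (hL : Submodule.IsLattice (RatFunc F) L) (hQ : IsDefinite Q)
    {Q' : QuadraticForm (RatFunc F) W'} {L' : Submodule F[X] W'}
    (hL' : Submodule.IsLattice (RatFunc F) L') (hQ' : IsDefinite Q')
    (h : ∀ a, repNumber L Q a = repNumber L' Q' a) (k : ℤ) :
    average ξ L (scaledForm π k Q) = average ξ L' (scaledForm π k Q') := by
  rw [average, average]
  congr 1
  funext m
  rw [partialAverage, partialAverage, filtration_scaledForm L Q hπ, filtration_scaledForm L' Q' hπ]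
  set m' := m + k * π.natDegree
  have : Finite (filtration L Q m') := (finite_filtration L hL Q hQ m').to_subtype
  have : Finite (filtration L' Q' m') := (finite_filtration L' hL' Q' hQ' m').to_subtype
  -- The fibre of `Q` over `a` in `L_m` is the full set of representations of `a` in `L` if `a`
  -- meets the degree bound, and empty otherwise. Matching fibres gives a bijection preserving
  -- values.
  have hfib : ∀ a : RatFunc F, Nonempty ({x : filtration L Q m' // Q x = a} ≃
      {x : filtration L' Q' m' // Q' x = a}) := by
    intro a
    apply Finite.card_eq.1
    by_cases ha : a = 0 ∨ a.intDegree ≤ m'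
    · have e1 : Nat.card {x : filtration L Q m' // Q x = a} = repNumber L Q a := by
        rw [repNumber, ← Nat.card_coe_set_eq]
        exact Nat.card_congr ⟨fun x => ⟨x.1.1, x.1.2.1, x.2⟩,
          fun x => ⟨⟨x.1, x.2.1, by rw [x.2.2]; exact ha⟩, x.2.2⟩, fun _ => rfl, fun _ => rfl⟩
      have e2 : Nat.card {x : filtration L' Q' m' // Q' x = a} = repNumber L' Q' a := by
        rw [repNumber, ← Nat.card_coe_set_eq]
        exact Nat.card_congr ⟨fun x => ⟨x.1.1, x.1.2.1, x.2⟩,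
          fun x => ⟨⟨x.1, x.2.1, by rw [x.2.2]; exact ha⟩, x.2.2⟩, fun _ => rfl, fun _ => rfl⟩
      rw [e1, e2, h]
    · have : IsEmpty {x : filtration L Q m' // Q x = a} :=
        ⟨fun x => ha (by rw [← x.2]; exact x.1.2.2)⟩
      have : IsEmpty {x : filtration L' Q' m' // Q' x = a} :=
        ⟨fun x => ha (by rw [← x.2]; exact x.1.2.2)⟩
      rw [Nat.card_of_isEmpty, Nat.card_of_isEmpty]
  let E : filtration L Q m' ≃ filtration L' Q' m' :=
    Equiv.ofFiberEquiv (f := fun x => Q x) (g := fun x => Q' x) fun a => (hfib a).some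
  have hE : ∀ x, Q' (E x) = Q x := fun x =>
    Equiv.ofFiberEquiv_map (f := fun x : filtration L Q m' => Q x)
      (g := fun x : filtration L' Q' m' => Q' x) (fun a => (hfib a).some) x
  rw [← finsum_set_coe_eq_finsum_mem, ← finsum_set_coe_eq_finsum_mem, ← Nat.card_coe_set_eq,
    ← Nat.card_coe_set_eq, Nat.card_congr E, ← finsum_comp_equiv E]
  congr 1
  refine finsum_congr fun x => ?_
  change canonicalChar ξ (_ * _) = canonicalChar ξ (_ * _)
  rw [hE]

end Average

/-! ### Local isometry from equal Jordan invariants -/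

section Local

variable {F : Type*} [Field F] {π : F[X]} (𝔭 : HeightOneSpectrum F[X])

theorem irreducible_of_asIdeal_eq (h𝔭 : 𝔭.asIdeal = Ideal.span {π}) : Irreducible π := by
  have hπ0 : π ≠ 0 := by
    rintro rfl
    exact 𝔭.ne_bot (by simpa using h𝔭)
  have := 𝔭.isPrime
  rw [h𝔭, Ideal.span_singleton_prime hπ0] at this
  exact this.irreducible

variable {𝔭} (h𝔭 : 𝔭.asIdeal = Ideal.span {π})
include h𝔭

theorem valuation_lt_one_iff {s : F[X]} :
    𝔭.valuation (RatFunc F) (algebraMap F[X] (RatFunc F) s) < 1 ↔ π ∣ s := by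
  rw [HeightOneSpectrum.valuation_lt_one_iff_mem, h𝔭, Ideal.mem_span_singleton]

theorem valuation_eq_one {s : F[X]} (hs : ¬ π ∣ s) :
    𝔭.valuation (RatFunc F) (algebraMap F[X] (RatFunc F) s) = 1 :=
  le_antisymm (𝔭.valuation_le_one s) (not_lt.1 (mt (valuation_lt_one_iff h𝔭).1 hs))

theorem valuation_le_one_of_mem {hirr : Irreducible π} {a : RatFunc F}
    (ha : a ∈ localSubring hirr) : 𝔭.valuation (RatFunc F) a ≤ 1 := by
  obtain ⟨s, c, hs, h⟩ := ha
  have := congrArg (𝔭.valuation (RatFunc F)) h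
  rw [map_mul, valuation_eq_one h𝔭 hs, one_mul] at this
  rw [this]
  exact 𝔭.valuation_le_one c

theorem nonneg_of_valuation_le_one {e : ℤ} {f : F[X]} (hf : ¬ π ∣ f)
    (h : 𝔭.valuation (RatFunc F)
      (algebraMap F[X] (RatFunc F) π ^ e * algebraMap F[X] (RatFunc F) f) ≤ 1) : 0 ≤ e := by
  have hirr := irreducible_of_asIdeal_eq 𝔭 h𝔭
  by_contra! hlt
  obtain ⟨m, hm⟩ : ∃ m : ℕ, e = -(m : ℤ) := ⟨e.natAbs, by omega⟩
  have hm0 : m ≠ 0 := by omega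
  have hv : 𝔭.valuation (RatFunc F) (algebraMap F[X] (RatFunc F) π) < 1 :=
    (valuation_lt_one_iff h𝔭).2 dvd_rfl
  have hv0 : 𝔭.valuation (RatFunc F) (algebraMap F[X] (RatFunc F) π) ≠ 0 :=
    (Valuation.ne_zero_iff _).2 (algebraMap_ne_zero_of_irreducible hirr)
  rw [map_mul, valuation_eq_one h𝔭 hf, mul_one, map_zpow₀, hm, zpow_neg, zpow_natCast] at h
  have h1 := pow_lt_one₀ zero_le hv hm0
  exact absurd h (not_le.2 ((one_lt_inv₀ (zero_lt_iff.2 (pow_ne_zero _ hv0))).2 h1))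

/-- Units in the same square class modulo `π` differ by the square of a `𝔭`-adic unit. -/
theorem exists_adicCompletion_sq_mul_eq [Finite F] (h2 : (2 : F) ≠ 0) {f f' : F[X]}
    (hf : ¬ π ∣ f) (hf' : ¬ π ∣ f') (h : IsSquareMod π (f * f')) :
    ∃ s : 𝔭.adicCompletion (RatFunc F), Valued.v s = 1 ∧
      s ^ 2 * algebraMap (RatFunc F) _ (algebraMap F[X] (RatFunc F) f') =
        algebraMap (RatFunc F) _ (algebraMap F[X] (RatFunc F) f) := by
  have hirr := irreducible_of_asIdeal_eq 𝔭 h𝔭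
  obtain ⟨c, hc⟩ := h
  have hc0 : ¬ π ∣ c := by
    intro h
    have h3 : π ∣ f * f' := by
      have := dvd_add hc (dvd_pow h two_ne_zero)
      rwa [sub_add_cancel] at this
    exact (hirr.prime.dvd_or_dvd h3).elim hf hf'
  have hcK := algebraMap_ne_zero_of_not_dvd hc0
  have hfK' := algebraMap_ne_zero_of_not_dvd hf'
  -- Write `ff' = c²(1 + u)` with `u` divisible by `π`, and let `r² = 1 + u`; then `s = rc/f'`
  -- satisfies `s²f' = f`.
  obtain ⟨r, hr⟩ := exists_sq_eq_one_add_adicCompletion h2 𝔭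
    (u := algebraMap F[X] (RatFunc F) (f * f' - c ^ 2) / algebraMap F[X] (RatFunc F) c ^ 2) (by
      rw [map_div₀, map_pow, valuation_eq_one h𝔭 hc0, one_pow, div_one]
      exact (valuation_lt_one_iff h𝔭).2 hc)
  set ι := algebraMap (RatFunc F) (𝔭.adicCompletion (RatFunc F))
  have hs : (r * ι (algebraMap F[X] (RatFunc F) c / algebraMap F[X] (RatFunc F) f')) ^ 2 *
      ι (algebraMap F[X] (RatFunc F) f') = ι (algebraMap F[X] (RatFunc F) f) := by
    rw [mul_pow, hr, ← map_pow ι, ← map_mul, ← map_mul]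
    congr 1
    simp only [map_sub, map_mul, map_pow]
    field_simp
    ring
  refine ⟨_, ?_, hs⟩
  have hv := congrArg Valued.v hs
  have hval : ∀ a : RatFunc F, Valued.v (ι a) = 𝔭.valuation (RatFunc F) a := fun a =>
    HeightOneSpectrum.valuedAdicCompletion_eq_valuation' 𝔭 a
  rw [map_mul, map_pow, hval, hval, valuation_eq_one h𝔭 hf, valuation_eq_one h𝔭 hf', mul_one] at hv
  exact (pow_eq_one_iff_of_nonneg zero_le two_ne_zero).1 hv

variable {W : Type*} [AddCommGroup W] [Module F[X] W]
  [Module (RatFunc F) W] {hirr : Irreducible π} [IsScalarTower F[X] (RatFunc F) W]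
  {Q : QuadraticForm (RatFunc F) W} {L : Submodule F[X] W} {n : ℕ} [Invertible (2 : RatFunc F)]

/-- The vectors of a Jordan splitting of a lattice, as a basis. -/
noncomputable def JordanSplitting.basis (J : JordanSplitting hirr Q L n)
    (hL : Submodule.IsLattice (RatFunc F) L) : Module.Basis (Fin n) (RatFunc F) W :=
  Module.Basis.mk (v := J.v)
    (Fintype.linearIndependent_iff.2 fun c hc i => by
      rw [← J.coord_sum_smul c i, hc, map_zero])
    (by
      rw [← hL.span_eq_top]
      refine Submodule.span_le.2 fun y hy => ?_
      obtain ⟨c, -, rfl⟩ := J.generates y hy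
      exact Submodule.sum_mem _ fun i _ =>
        Submodule.smul_mem _ _ (Submodule.subset_span (Set.mem_range_self i)))

omit h𝔭 in
theorem JordanSplitting.basis_apply (J : JordanSplitting hirr Q L n)
    (hL : Submodule.IsLattice (RatFunc F) L) (i : Fin n) : J.basis hL i = J.v i :=
  Module.Basis.mk_apply _ _ i

omit [IsScalarTower F[X] (RatFunc F) W] [Invertible (2 : RatFunc F)] in
-- Coefficients in the localization at `π` become `𝔭`-adic integers, so a Jordan splitting spans the
-- local lattice.
theorem localLattice_eq_span (J : JordanSplitting hirr Q L n) :
    localLattice 𝔭 L = Submodule.span (𝔭.adicCompletionIntegers (RatFunc F))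
      (Set.range fun i => (1 : 𝔭.adicCompletion (RatFunc F)) ⊗ₜ[RatFunc F] J.v i) := by
  apply le_antisymm
  · refine Submodule.span_le.2 ?_
    rintro _ ⟨y, hy, rfl⟩
    obtain ⟨c, hc, rfl⟩ := J.generates y hy
    change (1 : 𝔭.adicCompletion (RatFunc F)) ⊗ₜ[RatFunc F] (∑ i, c i • J.v i) ∈ _
    rw [TensorProduct.tmul_sum]
    refine Submodule.sum_mem _ fun i _ => ?_
    have hmem : algebraMap (RatFunc F) (𝔭.adicCompletion (RatFunc F)) (c i) ∈
        𝔭.adicCompletionIntegers (RatFunc F) := by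
      rw [HeightOneSpectrum.mem_adicCompletionIntegers]
      exact (HeightOneSpectrum.valuedAdicCompletion_eq_valuation' 𝔭 (c i)).trans_le
        (valuation_le_one_of_mem h𝔭 (hc i))
    have : (1 : 𝔭.adicCompletion (RatFunc F)) ⊗ₜ[RatFunc F] (c i • J.v i) =
        (⟨_, hmem⟩ : 𝔭.adicCompletionIntegers (RatFunc F)) •
          ((1 : 𝔭.adicCompletion (RatFunc F)) ⊗ₜ[RatFunc F] J.v i) := by
      rw [← TensorProduct.smul_tmul, TensorProduct.smul_tmul', Algebra.smul_def]
      rfl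
    rw [this]
    exact Submodule.smul_mem _ _ (Submodule.subset_span ⟨i, rfl⟩)
  · refine Submodule.span_le.2 ?_
    rintro _ ⟨i, rfl⟩
    exact Submodule.subset_span ⟨J.v i, J.mem i, rfl⟩

omit h𝔭 [IsScalarTower F[X] (RatFunc F) W] in
theorem baseChange_sum_smul (R : Type*) [Field R] [Algebra (RatFunc F) R]
    (J : JordanSplitting hirr Q L n) (c : Fin n → R) :
    Q.baseChange R (∑ i, c i • ((1 : R) ⊗ₜ[RatFunc F] J.v i)) =
      ∑ i, c i ^ 2 * algebraMap (RatFunc F) R (Q (J.v i)) := by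
  rw [map_sum_of_pairwise_polar_eq_zero]
  · refine Finset.sum_congr rfl fun i _ => ?_
    rw [QuadraticMap.map_smul, QuadraticForm.baseChange_tmul, smul_eq_mul, mul_one,
      Algebra.smul_def, mul_one, sq]
  · intro i _ j _ hij
    rw [QuadraticMap.polar_smul_left, QuadraticMap.polar_smul_right, polar_baseChange_one_tmul,
      J.polar_eq_zero hij, map_zero, smul_zero, smul_zero]

/-- Lattices with the same Jordan invariants are locally isometric. -/
theorem locallyIsometric_of_jordanSplitting [Finite F] {W' : Type*} [AddCommGroup W']
    [Module F[X] W'] [Module (RatFunc F) W'] [IsScalarTower F[X] (RatFunc F) W']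
    {Q' : QuadraticForm (RatFunc F) W'} {L' : Submodule F[X] W'}
    (hL : Submodule.IsLattice (RatFunc F) L) (hL' : Submodule.IsLattice (RatFunc F) L')
    (J : JordanSplitting hirr Q L n) (J' : JordanSplitting hirr Q' L' n)
    (h : ∀ i, J.e i = J'.e i ∧ IsSquareMod π (J.f i * J'.f i)) :
    LocallyIsometric 𝔭 L Q L' Q' := by
  set R := 𝔭.adicCompletion (RatFunc F)
  choose s hs1 hs2 using fun i => exists_adicCompletion_sq_mul_eq h𝔭 two_ne_zero_of_invertible
    (J.not_dvd i) (J'.not_dvd i) (h i).2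
  have hs0 : ∀ i, s i ≠ 0 := fun i h0 => by simpa [h0] using hs1 i
  let B : Module.Basis (Fin n) R (R ⊗[RatFunc F] W) := (J.basis hL).baseChange R
  let B' : Module.Basis (Fin n) R (R ⊗[RatFunc F] W') := (J'.basis hL').baseChange R
  have hB : ∀ i, B i = (1 : R) ⊗ₜ[RatFunc F] J.v i := fun i => by
    rw [Module.Basis.baseChange_apply, JordanSplitting.basis_apply]
  have hB' : ∀ i, B' i = (1 : R) ⊗ₜ[RatFunc F] J'.v i := fun i => by
    rw [Module.Basis.baseChange_apply, JordanSplitting.basis_apply]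
  -- The isometry sends `vᵢ` to `sᵢv'ᵢ`, where `sᵢ²f'ᵢ = fᵢ`. Each `sᵢ` is a unit, so lattice goes
  -- onto lattice.
  let E : R ⊗[RatFunc F] W ≃ₗ[R] R ⊗[RatFunc F] W' :=
    B.equiv (B'.unitsSMul fun i => Units.mk0 (s i) (hs0 i)) (Equiv.refl _)
  have hE : ∀ i, E ((1 : R) ⊗ₜ[RatFunc F] J.v i) = s i • ((1 : R) ⊗ₜ[RatFunc F] J'.v i) := by
    intro i
    rw [← hB, ← hB', Module.Basis.equiv_apply, Module.Basis.unitsSMul_apply]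
    rfl
  have hform : ∀ x, Q'.baseChange R (E x) = Q.baseChange R x := by
    intro x
    rw [← B.sum_repr x]
    simp only [hB, map_sum, map_smul, hE, smul_smul]
    rw [baseChange_sum_smul, baseChange_sum_smul]
    refine Finset.sum_congr rfl fun i _ => ?_
    rw [J.apply_eq, J'.apply_eq, (h i).1, map_mul, map_mul, ← hs2 i]
    ring
  have hmap : (localLattice 𝔭 L).map
      ((E.restrictScalars (𝔭.adicCompletionIntegers (RatFunc F))) :
        R ⊗[RatFunc F] W →ₗ[𝔭.adicCompletionIntegers (RatFunc F)] R ⊗[RatFunc F] W') =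
      localLattice 𝔭 L' := by
    rw [localLattice_eq_span h𝔭 J, localLattice_eq_span h𝔭 J', Submodule.map_span, ← Set.range_comp]
    have hint : ∀ a : R, Valued.v a = 1 → a ∈ 𝔭.adicCompletionIntegers (RatFunc F) := fun a ha =>
      (HeightOneSpectrum.mem_adicCompletionIntegers _ _ _).2 ha.le
    apply le_antisymm
    · refine Submodule.span_le.2 ?_
      rintro _ ⟨i, rfl⟩
      change E _ ∈ _
      rw [hE]
      exact Submodule.smul_mem _ (⟨s i, hint _ (hs1 i)⟩ : 𝔭.adicCompletionIntegers (RatFunc F))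
        (Submodule.subset_span ⟨i, rfl⟩)
    · refine Submodule.span_le.2 ?_
      rintro _ ⟨i, rfl⟩
      have hsi : Valued.v (s i)⁻¹ = 1 := by rw [map_inv₀, hs1, inv_one]
      have h1 : (⟨(s i)⁻¹, hint _ hsi⟩ : 𝔭.adicCompletionIntegers (RatFunc F)) •
          (E ((1 : R) ⊗ₜ[RatFunc F] J.v i)) ∈
          Submodule.span (𝔭.adicCompletionIntegers (RatFunc F))
            (Set.range (fun i => E ((1 : R) ⊗ₜ[RatFunc F] J.v i))) :=
        Submodule.smul_mem _ _ (Submodule.subset_span ⟨i, rfl⟩)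
      have h2 : (⟨(s i)⁻¹, hint _ hsi⟩ : 𝔭.adicCompletionIntegers (RatFunc F)) •
          (E ((1 : R) ⊗ₜ[RatFunc F] J.v i)) = (1 : R) ⊗ₜ[RatFunc F] J'.v i := by
        rw [hE]
        exact inv_smul_smul₀ (hs0 i) ((1 : R) ⊗ₜ[RatFunc F] J'.v i)
      rw [h2] at h1
      exact h1
  refine ⟨(E.restrictScalars (𝔭.adicCompletionIntegers (RatFunc F))).ofSubmodules _ _ hmap,
    fun x => hform x⟩

/-- The averages for `k ≥ k₀` determine the local isometry class, when `π^{-k₀} Q` is integral. -/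
theorem locallyIsometric_of_average_eq [Finite F] {ξ : AlgebraicClosure F} (hξ : aeval ξ π = 0)
    {W' : Type*} [AddCommGroup W']
    [Module F[X] W'] [Module (RatFunc F) W'] [IsScalarTower F[X] (RatFunc F) W']
    {Q' : QuadraticForm (RatFunc F) W'} {L' : Submodule F[X] W'}
    (hQ : IsDefinite Q) (hL : Submodule.IsLattice (RatFunc F) L) (hQ' : IsDefinite Q')
    (hL' : Submodule.IsLattice (RatFunc F) L')
    (J : JordanSplitting hirr Q L n) (k₀ : ℤ) (hk₀ : ∀ i, k₀ ≤ J.e i)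
    (h : ∀ k ≥ k₀, average ξ L (scaledForm π k Q) = average ξ L' (scaledForm π k Q')) :
    LocallyIsometric 𝔭 L Q L' Q' := by
  obtain ⟨n', ⟨J'⟩⟩ := nonempty_jordanSplitting hirr Q' hQ'.anisotropic L' hL'.fg
  obtain ⟨rfl, hn⟩ := jordan_invariants_eq hirr hξ two_ne_zero_of_invertible k₀ n n' J.e J.f
    J'.e J'.f J.not_dvd J'.not_dvd J.sorted J'.sorted hk₀ fun k hk => by
      rw [← average_eq J hξ hL hQ, ← average_eq J' hξ hL' hQ', h k hk]
  exact locallyIsometric_of_jordanSplitting h𝔭 hL hL' J J' hn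

end Local

end Lattices

/-! ### The theorem -/

theorem mainTheorem5 {F : Type*} [Field F] [Finite F] [Invertible (2 : RatFunc F)]
    (𝔭 : HeightOneSpectrum F[X]) (π : F[X]) (hπ : π.Monic) (h𝔭 : 𝔭.asIdeal = Ideal.span {π})
    (ξ : AlgebraicClosure F) (hξ : aeval ξ π = 0)
    {W : Type*} [AddCommGroup W] [Module F[X] W] [Module (RatFunc F) W]
    [IsScalarTower F[X] (RatFunc F) W]
    (Q : QuadraticForm (RatFunc F) W) (hQ : Lattices.IsDefinite Q)
    (L : Submodule F[X] W) (hL : Submodule.IsLattice (RatFunc F) L)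
    {W' : Type*} [AddCommGroup W'] [Module F[X] W'] [Module (RatFunc F) W']
    [IsScalarTower F[X] (RatFunc F) W']
    (Q' : QuadraticForm (RatFunc F) W') (hQ' : Lattices.IsDefinite Q')
    (L' : Submodule F[X] W') (hL' : Submodule.IsLattice (RatFunc F) L') :
    -- the averages are well defined, as limits of eventually constant sequences
    (∀ k : ℤ,
      (∀ m : ℤ, (Lattices.filtration L (Lattices.scaledForm π k Q) m).Finite) ∧
      ∀ᶠ m in atTop, Lattices.partialAverage ξ L (Lattices.scaledForm π k Q) m =
        Lattices.average ξ L (Lattices.scaledForm π k Q)) ∧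
    -- they are determined by the representation numbers
    ((∀ a : RatFunc F, Lattices.repNumber L Q a = Lattices.repNumber L' Q' a) →
      ∀ k : ℤ, Lattices.average ξ L (Lattices.scaledForm π k Q) =
        Lattices.average ξ L' (Lattices.scaledForm π k Q')) ∧
    -- if `Q` is `𝔭`-integral on `L`, those with `k = 0, 1, 2, …` determine the local class
    (Lattices.IsIntegralAt 𝔭 L Q →
      (∀ k : ℕ, Lattices.average ξ L (Lattices.scaledForm π k Q) =
        Lattices.average ξ L' (Lattices.scaledForm π k Q')) →
      Lattices.LocallyIsometric 𝔭 L Q L' Q') ∧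
    -- without integrality, those with `k ∈ ℤ` determine the local class
    ((∀ k : ℤ, Lattices.average ξ L (Lattices.scaledForm π k Q) =
        Lattices.average ξ L' (Lattices.scaledForm π k Q')) →
      Lattices.LocallyIsometric 𝔭 L Q L' Q') := by
  have hirr := Lattices.irreducible_of_asIdeal_eq 𝔭 h𝔭
  obtain ⟨n, ⟨J⟩⟩ := Lattices.nonempty_jordanSplitting hirr Q hQ.anisotropic L hL.fg
  refine ⟨fun k => ⟨fun m => ?_, ?_⟩, fun h k => ?_, fun hint h => ?_, fun h => ?_⟩
  · rw [Lattices.filtration_scaledForm L Q hirr.ne_zero]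
    exact Lattices.finite_filtration L hL Q hQ _
  · rw [Lattices.average_eq J hξ hL hQ]
    exact Lattices.eventually_partialAverage_eq J hξ hL hQ k
  · exact Lattices.average_eq_of_repNumber_eq ξ hirr.ne_zero hL hQ hL' hQ' h k
  -- Integrality of `Q` on `L` makes all exponents of `J` nonnegative, so `k₀ = 0` works; nothing is
  -- needed for `L'`.
  · refine Lattices.locallyIsometric_of_average_eq h𝔭 hξ hQ hL hQ' hL' J 0 (fun i => ?_)
      fun k hk => ?_
    · exact Lattices.nonneg_of_valuation_le_one h𝔭 (J.not_dvd i)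
        (J.apply_eq i ▸ hint _ (J.mem i))
    · obtain ⟨m, rfl⟩ := Int.eq_ofNat_of_zero_le hk
      exact h m
  -- Without integrality any lower bound of the finitely many exponents serves as `k₀`.
  · obtain ⟨k₀, hk₀⟩ := Finite.exists_ge J.e
    exact Lattices.locallyIsometric_of_average_eq h𝔭 hξ hQ hL hQ' hL' J k₀ hk₀ fun k _ => h k
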